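/- Let $R_1,R_2>0$ and let $S^2\times S^2\subset\mathbb R^3\times\mathbb R^3$, with coordinates $(x_1,y_1,z_1,x_2,y_2,z_2)$, carry the symplectic form $\omega=R_1\omega_{S^2}\oplus R_2\omega_{S^2}$, where $\omega_{S^2}$ is the standard area form. Consider the rational Gaudin model $$J=R_1z_1+R_2z_2,\qquad H_{t_4}=t_1z_1+t_2z_2+t_3(x_1x_2+y_1y_2)+t_4z_1z_2,$$ let $m_0=(0,0,1,0,0,-1)$ and $$t_{4,m_0}^{+}=\frac{t_1R_2-t_2R_1+2t_3\sqrt{R_1R_2}}{R_1+R_2}.$$ For canonical coordinates $(q_1,q_2,p_1,p_2)$ put $S=q_1p_2-q_2p_1$, $M=\tfrac12(q_1^2+q_2^2)$, $N=\tfrac12(p_1^2+p_2^2)$. We say that a family $H_t$ goes through a degenerate Hamiltonian Hopf bifurcation at a point $m$ and $t=\tau$ if there are $\rho\neq0$, $\sigma=\pm1$ and canonical coordinates around $m$ (i.e. $\omega=dq_1\wedge dp_1+dq_2\wedge dp_2$, with $m$ at the origin), depending smoothly on $t$ near $\tau$, such that 1. for all $t$ near $\tau$, $m$ is a singularity of rank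 $0$ of $(J,H_t)$, and the second order part of $H_t$ at $m$ is $(\rho+\nu_1(t))S+\sigma N-\nu_2(t)M$ with smooth functions $\nu_1,\nu_2$ satisfying $\nu_1(\tau)=\nu_2(\tau)=0$ and $\nu_2'(\tau)\ne0$; 2. at $t=\tau$, $H_\tau$ is in normal form up to sixth order, that is, up to an additive constant and terms of order at least $7$, $$H_\tau=\rho S+\sigma N+a_3M^2+a_4MS+a_5S^2+a_6M^3+a_7M^2S+a_8MS^2+a_9S^3;$$ 3. $a_3=0$ and $a_6\neq0$. **Corollary.** Suppose that $$t_3=\frac{2\sqrt{R_1R_2}\,(R_2t_1-R_1t_2)}{(R_1-R_2)^2},\quad R_1\ne R_2,\quad R_1t_2\ne R_2t_1,\quad R_1(t_1+2t_2)\ne R_2(2t_1+t_2),\quad t_1\neq t_2 .$$ Then $H_{t_4}$ goes through a degenerate Hamiltonian Hopf bifurcation at $m_0$ and $t_4=t_{4,m_0}^{+}$. -/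

import Mathlib

open Set Asymptotics
open scoped Topology ContDiff Matrix

/-- The ambient space `ℝ³ × ℝ³` of `S² × S²`; a point is `((x₁, y₁, z₁), (x₂, y₂, z₂))`. -/
abbrev GaudinAmbient : Type := (Fin 3 → ℝ) × (Fin 3 → ℝ)

/-- The phase space `S² × S²`, as a subset of `ℝ³ × ℝ³`. -/
def gaudinPhaseSpace : Set GaudinAmbient :=
  {v | v.1 0 ^ 2 + v.1 1 ^ 2 + v.1 2 ^ 2 = 1 ∧ v.2 0 ^ 2 + v.2 1 ^ 2 + v.2 2 ^ 2 = 1}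

/-- The symplectic form `R₁ ω_{S²} ⊕ R₂ ω_{S²}` at the point `v`, evaluated on the tangent vectors
`a` and `b`. Here `ω_{S²}` is the area form `(a, b) ↦ ⟨v, a × b⟩`, which is `dx ∧ dy / z` in the
coordinates `(x, y)` on a hemisphere. -/
def gaudinForm (R₁ R₂ : ℝ) (v a b : GaudinAmbient) : ℝ :=
  R₁ * (v.1 ⬝ᵥ (a.1 ⨯₃ b.1)) + R₂ * (v.2 ⬝ᵥ (a.2 ⨯₃ b.2))

/-- The first integral `J = R₁ z₁ + R₂ z₂`. -/
def gaudinJ (R₁ R₂ : ℝ) (v : GaudinAmbient) : ℝ := R₁ * v.1 2 + R₂ * v.2 2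

/-- The generalised Gaudin Hamiltonian
`t₀ (z₁ + z₂)² + w (t₁ z₁ + t₂ z₂) + t₃ (x₁ x₂ + y₁ y₂) + t₄ z₁ z₂`. -/
def gaudinH (w t₀ t₁ t₂ t₃ t₄ : ℝ) (v : GaudinAmbient) : ℝ :=
  t₀ * (v.1 2 + v.2 2) ^ 2 + w * (t₁ * v.1 2 + t₂ * v.2 2)
    + t₃ * (v.1 0 * v.2 0 + v.1 1 * v.2 1) + t₄ * (v.1 2 * v.2 2)

/-- The Hamiltonian of the rational Gaudin model: `t₀ = 0` and `w = 1`. -/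
def rationalGaudinH (t₁ t₂ t₃ t₄ : ℝ) : GaudinAmbient → ℝ := gaudinH 1 0 t₁ t₂ t₃ t₄

/-- The point `m₀ = (0, 0, 1, 0, 0, -1)`. -/
def gaudinM0 : GaudinAmbient := (![0, 0, 1], ![0, 0, -1])

/-- The bifurcation value `t_{4,m₀}⁺`. -/
noncomputable def t4m0Plus (R₁ R₂ w t₁ t₂ t₃ : ℝ) : ℝ :=
  (w * (t₁ * R₂ - t₂ * R₁) + 2 * t₃ * √(R₁ * R₂)) / (R₁ + R₂)

/-- `ℝ⁴` with the canonical coordinates `(q₁, q₂, p₁, p₂) = (u 0, u 1, u 2, u 3)`. -/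
abbrev CanonicalSpace : Type := Fin 4 → ℝ

/-- The standard symplectic form `dq₁ ∧ dp₁ + dq₂ ∧ dp₂`. -/
def standardForm (a b : CanonicalSpace) : ℝ :=
  (a 0 * b 2 - a 2 * b 0) + (a 1 * b 3 - a 3 * b 1)

/-- The Hilbert generator `S = q₁ p₂ - q₂ p₁`. -/
def hilbertS (u : CanonicalSpace) : ℝ := u 0 * u 3 - u 1 * u 2

/-- The Hilbert generator `M = (q₁² + q₂²) / 2`. -/
noncomputable def hilbertM (u : CanonicalSpace) : ℝ := (u 0 ^ 2 + u 1 ^ 2) / 2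

/-- The Hilbert generator `N = (p₁² + p₂²) / 2`. -/
noncomputable def hilbertN (u : CanonicalSpace) : ℝ := (u 2 ^ 2 + u 3 ^ 2) / 2

/-- `ψ` gives canonical coordinates on `S² × S²` around `z₀`, with coordinate domain `U`: it is a
smooth injective map from the neighbourhood `U` of `0` in `ℝ⁴` to `S² × S²`, it sends `0` to `z₀`,
and it pulls `R₁ ω_{S²} ⊕ R₂ ω_{S²}` back to the standard symplectic form. (The last condition makes
it an immersion between manifolds of dimension four, hence a diffeomorphism onto an open subset.) -/
structure IsCanonicalCoordinates (R₁ R₂ : ℝ) (z₀ : GaudinAmbient) (U : Set CanonicalSpace)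
    (ψ : CanonicalSpace → GaudinAmbient) : Prop where
  isOpen : IsOpen U
  zero_mem : (0 : CanonicalSpace) ∈ U
  map_zero : ψ 0 = z₀
  contDiffOn : ContDiffOn ℝ ∞ ψ U
  injOn : InjOn ψ U
  mapsTo : MapsTo ψ U gaudinPhaseSpace
  symplectic : ∀ u ∈ U, ∀ a b : CanonicalSpace,
    gaudinForm R₁ R₂ (ψ u) (fderiv ℝ ψ u a) (fderiv ℝ ψ u b) = standardForm a b

/-- A one-parameter family `t ↦ H t` of Hamiltonians on `S² × S²`, with first integral `J`, goes
through a linear Hamiltonian Hopf bifurcation at `z₀` and `t = τ`, with data `ρ ≠ 0`, `σ = ±1`,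
as exhibited by the canonical coordinates `Ψ t : U → S² × S²`, which depend smoothly on the
parameter `t ∈ (τ - ε, τ + ε)`.

For all these `t`, the point `z₀` is a singularity of rank zero of `(J, H t)`, and the terms of
second order of `H t` are `(ρ + ν₁(t)) S + σ N - ν₂(t) M`, where `ν₁(τ) = ν₂(τ) = 0` and
`ν₂'(τ) ≠ 0` (the transversality condition). -/
structure IsLinearHopfUnfolding (R₁ R₂ : ℝ) (J : GaudinAmbient → ℝ) (H : ℝ → GaudinAmbient → ℝ)
    (z₀ : GaudinAmbient) (τ ρ σ ε : ℝ) (ν₁ ν₂ : ℝ → ℝ) (U : Set CanonicalSpace)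
    (Ψ : ℝ → CanonicalSpace → GaudinAmbient) : Prop where
  rho_ne_zero : ρ ≠ 0
  sigma_eq : σ = 1 ∨ σ = -1
  eps_pos : 0 < ε
  nu₁_smooth : ContDiffOn ℝ ∞ ν₁ (Ioo (τ - ε) (τ + ε))
  nu₂_smooth : ContDiffOn ℝ ∞ ν₂ (Ioo (τ - ε) (τ + ε))
  nu₁_zero : ν₁ τ = 0
  nu₂_zero : ν₂ τ = 0
  transversal : deriv ν₂ τ ≠ 0
  coordinates_smooth : ContDiffOn ℝ ∞ (fun x : ℝ × CanonicalSpace => Ψ x.1 x.2)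
    (Ioo (τ - ε) (τ + ε) ×ˢ U)
  coordinates : ∀ t ∈ Ioo (τ - ε) (τ + ε), IsCanonicalCoordinates R₁ R₂ z₀ U (Ψ t)
  rank_zero : ∀ t ∈ Ioo (τ - ε) (τ + ε), fderiv ℝ (fun u => (J (Ψ t u), H t (Ψ t u))) 0 = 0
  second_order : ∀ t ∈ Ioo (τ - ε) (τ + ε),
    (fun u => H t (Ψ t u) - H t z₀
      - ((ρ + ν₁ t) * hilbertS u + σ * hilbertN u - ν₂ t * hilbertM u))
        =O[𝓝 0] (fun u => ‖u‖ ^ 3)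

/-- In the canonical coordinates `ψ` around `z₀`, the function `h` is in Hamiltonian Hopf normal
form up to order six (third order in the Hilbert generators): up to an additive constant,
`h = ρ S + σ N + a₃ M² + a₄ M S + a₅ S² + a₆ M³ + a₇ M² S + a₈ M S² + a₉ S³ + O(7)`. -/
def IsHopfNormalForm (h : GaudinAmbient → ℝ) (z₀ : GaudinAmbient)
    (ψ : CanonicalSpace → GaudinAmbient) (ρ σ a₃ a₄ a₅ a₆ a₇ a₈ a₉ : ℝ) : Prop :=
  (fun u => h (ψ u) - h z₀
    - (ρ * hilbertS u + σ * hilbertN u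
      + a₃ * hilbertM u ^ 2 + a₄ * (hilbertM u * hilbertS u) + a₅ * hilbertS u ^ 2
      + a₆ * hilbertM u ^ 3 + a₇ * (hilbertM u ^ 2 * hilbertS u)
      + a₈ * (hilbertM u * hilbertS u ^ 2) + a₉ * hilbertS u ^ 3))
    =O[𝓝 0] (fun u => ‖u‖ ^ 7)

/-- The family `t ↦ H t` of Hamiltonians on `S² × S²`, with first integral `J`, goes through a
degenerate Hamiltonian Hopf bifurcation at `z₀` and `t = τ`: there is a Hamiltonian Hopf bifurcation
at `z₀` and `t = τ`, and in the normal form of `H τ` the coefficient `a₃` of `M²` is zero while the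
coefficient `a₆` of `M³` is not. -/
def DegenerateHamiltonianHopf (R₁ R₂ : ℝ) (J : GaudinAmbient → ℝ) (H : ℝ → GaudinAmbient → ℝ)
    (z₀ : GaudinAmbient) (τ : ℝ) : Prop :=
  ∃ (ρ σ ε : ℝ) (ν₁ ν₂ : ℝ → ℝ) (U : Set CanonicalSpace)
    (Ψ : ℝ → CanonicalSpace → GaudinAmbient) (a₃ a₄ a₅ a₆ a₇ a₈ a₉ : ℝ),
    IsLinearHopfUnfolding R₁ R₂ J H z₀ τ ρ σ ε ν₁ ν₂ U Ψ ∧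
    IsHopfNormalForm (H τ) z₀ (Ψ τ) ρ σ a₃ a₄ a₅ a₆ a₇ a₈ a₉ ∧
    a₃ = 0 ∧ a₆ ≠ 0

/-!
In suitable canonical coordinates around `m₀` we have `J - J(m₀) = S`, and the Hamiltonian is a
function of `S`, `M`, `N` whose second order part is `ρ S + (α + β) N + (α - β) M` with `β` a
multiple of `t₃`; the bifurcation occurs at `α = β`.

The functions of `S`, `M`, `Q = q₁ p₁ + q₂ p₂` and `N` are closed under the Poisson bracket, in
which `S` is central and `M`, `Q`, `N` span `sl₂`. A homogeneous rotation-invariant function can be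
normalised by flows of Hamiltonians in the span of the products `S ^ j * L ^ i * L'`, where
`L = M + s Q + s² N`: such flows preserve `L` and `S` and are therefore explicit. What survives are
the polynomials in `S` and `M`, and the restriction to the `q`-axis, where only `M` is nonzero,
reads off the coefficient `a₃` of `M²`. Instead of computing the sixth order terms, `a₆ ≠ 0` is
deduced from the fact that on `{S = 0}` the Hamiltonian at the resonance satisfies
`(H - H(m₀)) / β ≥ c M³` with `c > 0`, a bound which survives every rotation-invariant symplectic
change of coordinates up to the value of `c`.
-/

/-! ### Orders of vanishing -/

/-- The functions on `ℝ⁴` of order at least `k` at the origin: `F = O(‖u‖ ^ k)`. -/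
def vanishing (k : ℕ) : Submodule ℝ (CanonicalSpace → ℝ) where
  carrier := {F | F =O[𝓝 0] fun u => ‖u‖ ^ k}
  zero_mem' := isBigO_zero _ _
  add_mem' := IsBigO.add
  smul_mem' c _ hF := hF.const_smul_left c

theorem vanishing_antitone : Antitone vanishing := fun l k h F hF => by
  refine IsBigO.trans hF (IsBigO.of_bound' ?_)
  filter_upwards [Metric.ball_mem_nhds (0 : CanonicalSpace) one_pos] with u hu
  rw [norm_pow, norm_pow, norm_norm]
  exact pow_le_pow_of_le_one (norm_nonneg u) (mem_ball_zero_iff.1 hu).le h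

theorem mul_mem_vanishing {k l : ℕ} {F G : CanonicalSpace → ℝ} (hF : F ∈ vanishing k)
    (hG : G ∈ vanishing l) : F * G ∈ vanishing (k + l) := by
  change (F * G) =O[𝓝 0] fun u => ‖u‖ ^ (k + l)
  simp only [pow_add]
  exact IsBigO.mul hF hG

theorem mem_vanishing_zero {F : CanonicalSpace → ℝ} (hF : ContinuousAt F 0) :
    F ∈ vanishing 0 := by
  change F =O[𝓝 0] fun u => ‖u‖ ^ 0
  simpa only [pow_zero] using hF.tendsto.isBigO_one ℝ

theorem comp_mem_vanishing {k : ℕ} {F : CanonicalSpace → ℝ} (hF : F ∈ vanishing k)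
    {Φ : CanonicalSpace → CanonicalSpace} (h0 : Φ 0 = 0) (hΦ : DifferentiableAt ℝ Φ 0) :
    F ∘ Φ ∈ vanishing k := by
  have hlim : Filter.Tendsto Φ (𝓝 0) (𝓝 0) := by
    simpa only [h0] using hΦ.continuousAt.tendsto
  have hlin : Φ =O[𝓝 0] fun u => u := by
    simpa only [h0, sub_zero] using hΦ.hasFDerivAt.isBigO_sub
  exact (IsBigO.comp_tendsto hF hlim).trans (hlin.norm_norm.pow k)

theorem coord_mem_vanishing (i : Fin 4) : (fun u : CanonicalSpace => u i) ∈ vanishing 1 :=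
  IsBigO.of_bound' (.of_forall fun u => by
    simpa only [pow_one, norm_norm] using norm_le_pi_norm u i)

/-! ### Rotation invariants and the pencil of squares -/

/-- The invariant `Q = q₁ p₁ + q₂ p₂`, which together with `M`, `N`, `S` generates the invariant
polynomials of the circle action with momentum map `S`. -/
def hilbertQ (u : CanonicalSpace) : ℝ := u 0 * u 2 + u 1 * u 3

theorem hilbertQ_sq : hilbertQ ^ 2 = 4 * hilbertM * hilbertN - hilbertS ^ 2 := by
  funext u
  simp only [Pi.pow_apply, Pi.sub_apply, Pi.mul_apply, Pi.ofNat_apply, hilbertQ, hilbertM,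
    hilbertN, hilbertS]
  ring

/-- The space `V` of invariant quadratic forms, so that `V ^ k` consists of the invariant forms of
degree `2 * k`. -/
noncomputable def invariantForms : Submodule ℝ (CanonicalSpace → ℝ) :=
  Submodule.span ℝ {hilbertM, hilbertN, hilbertQ, hilbertS}

theorem hilbertM_mem : hilbertM ∈ invariantForms := Submodule.subset_span (by simp)

theorem hilbertN_mem : hilbertN ∈ invariantForms := Submodule.subset_span (by simp)

theorem hilbertQ_mem : hilbertQ ∈ invariantForms := Submodule.subset_span (by simp)

theorem hilbertS_mem : hilbertS ∈ invariantForms := Submodule.subset_span (by simp)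

theorem invariantForms_le_vanishing : invariantForms ≤ vanishing 2 := by
  have product (i j : Fin 4) : (fun u : CanonicalSpace => u i) * (fun u => u j) ∈ vanishing 2 :=
    mul_mem_vanishing (coord_mem_vanishing i) (coord_mem_vanishing j)
  have half_squares (i j : Fin 4) :
      (fun u : CanonicalSpace => (u i ^ 2 + u j ^ 2) / 2) ∈ vanishing 2 := by
    convert (vanishing 2).smul_mem 2⁻¹ (add_mem (product i i) (product j j)) using 1
    funext u
    simp only [Pi.smul_apply, Pi.add_apply, Pi.mul_apply, smul_eq_mul]
    ring
  rw [invariantForms, Submodule.span_le]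
  rintro _ (rfl | rfl | rfl | rfl)
  · exact half_squares 0 1
  · exact half_squares 2 3
  · exact add_mem (product 0 2) (product 1 3)
  · exact sub_mem (product 0 3) (product 1 2)

/-- The invariant polynomials all of whose terms have degree at least `2 * m`. -/
noncomputable def invariantsFrom (m : ℕ) : Submodule ℝ (CanonicalSpace → ℝ) :=
  ⨆ k, invariantForms ^ (m + k)

theorem pow_le_invariantsFrom {m k : ℕ} (h : m ≤ k) : invariantForms ^ k ≤ invariantsFrom m := by
  obtain ⟨j, rfl⟩ := Nat.exists_eq_add_of_le h
  exact le_iSup (fun j => invariantForms ^ (m + j)) j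

theorem invariantsFrom_antitone : Antitone invariantsFrom := fun _ _ h =>
  iSup_le fun _ => pow_le_invariantsFrom (by lia)

theorem invariantsFrom_mul_le (m l : ℕ) :
    invariantsFrom m * invariantsFrom l ≤ invariantsFrom (m + l) := by
  simp only [invariantsFrom, Submodule.iSup_mul, Submodule.mul_iSup, ← pow_add]
  exact iSup_le fun _ => iSup_le fun _ => pow_le_invariantsFrom (by lia)

theorem mul_mem_invariantsFrom {m l : ℕ} {f g : CanonicalSpace → ℝ} (hf : f ∈ invariantsFrom m)
    (hg : g ∈ invariantsFrom l) : f * g ∈ invariantsFrom (m + l) :=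
  invariantsFrom_mul_le m l (Submodule.mul_mem_mul hf hg)

theorem invariantsFrom_le_sup (m : ℕ) :
    invariantsFrom m ≤ invariantForms ^ m ⊔ invariantsFrom (m + 1) := by
  refine iSup_le fun k => ?_
  cases k with
  | zero => exact le_sup_left
  | succ k => exact (pow_le_invariantsFrom (by lia)).trans le_sup_right

theorem pow_le_vanishing (k : ℕ) : invariantForms ^ k ≤ vanishing (2 * k) := by
  induction k with
  | zero =>
    rw [pow_zero, Submodule.one_eq_span, Submodule.span_singleton_le_iff_mem]
    exact mem_vanishing_zero continuousAt_const
  | succ k ih =>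
    rw [pow_succ, Submodule.mul_le]
    exact fun f hf g hg => mul_mem_vanishing (ih hf) (invariantForms_le_vanishing hg)

theorem invariantsFrom_le_vanishing (m : ℕ) : invariantsFrom m ≤ vanishing (2 * m) :=
  iSup_le fun _ => (pow_le_vanishing _).trans (vanishing_antitone (by lia))

/-- `L_s = M + s Q + s² N = |q + s p|² / 2`, the value at `s` of the quadratic pencil attached to
the `sl₂`-triple `M`, `Q`, `N`. -/
noncomputable def pencil (s : ℝ) : CanonicalSpace → ℝ :=
  hilbertM + s • hilbertQ + s ^ 2 • hilbertN

/-- The derivative `Q + 2 s N` of `L_s` with respect to `s`. -/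
noncomputable def pencilDeriv (s : ℝ) : CanonicalSpace → ℝ := hilbertQ + (2 * s) • hilbertN

theorem pencil_mem (s : ℝ) : pencil s ∈ invariantForms :=
  add_mem (add_mem hilbertM_mem (Submodule.smul_mem _ _ hilbertQ_mem))
    (Submodule.smul_mem _ _ hilbertN_mem)

theorem pencilDeriv_mem (s : ℝ) : pencilDeriv s ∈ invariantForms :=
  add_mem hilbertQ_mem (Submodule.smul_mem _ _ hilbertN_mem)

theorem invariantForms_le_span_pencil (s : ℝ) :
    invariantForms ≤ Submodule.span ℝ {pencil s, pencilDeriv s, hilbertN, hilbertS} := by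
  have hL : pencil s ∈ Submodule.span ℝ {pencil s, pencilDeriv s, hilbertN, hilbertS} :=
    Submodule.subset_span (by simp)
  have hL' : pencilDeriv s ∈ Submodule.span ℝ {pencil s, pencilDeriv s, hilbertN, hilbertS} :=
    Submodule.subset_span (by simp)
  have hN : hilbertN ∈ Submodule.span ℝ {pencil s, pencilDeriv s, hilbertN, hilbertS} :=
    Submodule.subset_span (by simp)
  rw [invariantForms, Submodule.span_le]
  rintro _ (rfl | rfl | rfl | rfl)
  · have : hilbertM = pencil s - s • pencilDeriv s + s ^ 2 • hilbertN := by
      rw [pencil, pencilDeriv]; module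
    exact this ▸ add_mem (sub_mem hL (Submodule.smul_mem _ _ hL')) (Submodule.smul_mem _ _ hN)
  · exact hN
  · have : hilbertQ = pencilDeriv s - (2 * s) • hilbertN := by rw [pencilDeriv]; module
    exact this ▸ sub_mem hL' (Submodule.smul_mem _ _ hN)
  · exact Submodule.subset_span (by simp)

section PolynomialPencils

open Polynomial

variable {A : Type*} [CommRing A]

/-- The coefficients are recovered from the values because a linear functional that vanishes on `W`
turns the pencil into a scalar polynomial with infinitely many roots. -/
theorem coeff_mem_of_forall_eval_mem {K : Type*} [Field K] [Infinite K] [Algebra K A]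
    {W : Submodule K A} {p : A[X]} (hp : ∀ s : K, p.eval (algebraMap K A s) ∈ W) (m : ℕ) :
    p.coeff m ∈ W := by
  by_contra hm
  obtain ⟨f, hfm, hfW⟩ := Submodule.exists_le_ker_of_notMem hm
  let scalar : K[X] := ∑ i ∈ Finset.range (p.natDegree + 1), monomial i (f (p.coeff i))
  have scalar_coeff : scalar.coeff m = f (p.coeff m) := by
    simp only [scalar, finsetSum_coeff, coeff_monomial, Finset.sum_ite_eq', Finset.mem_range]
    split_ifs with h
    · rfl
    · rw [coeff_eq_zero_of_natDegree_lt (by lia), map_zero]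
  have scalar_eq_zero : scalar = 0 := by
    refine Polynomial.funext fun s => ?_
    have hs : f (p.eval (algebraMap K A s)) = 0 := hfW (hp s)
    rw [eval_eq_sum_range] at hs
    simp only [← map_pow, mul_comm (p.coeff _), ← Algebra.smul_def, map_sum, map_smul,
      smul_eq_mul] at hs
    simpa only [scalar, eval_finsetSum, eval_monomial, eval_zero, mul_comm (f _)] using hs
  exact hfm (by rw [← scalar_coeff, scalar_eq_zero, coeff_zero])

theorem eval_mem_of_forall_coeff_mem {R : Type*} [CommRing R] [Algebra R A] {W : Submodule R A}
    {p : A[X]} (hp : ∀ m, p.coeff m ∈ W) (s : R) : p.eval (algebraMap R A s) ∈ W := by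
  rw [eval_eq_sum_range]
  refine sum_mem fun m _ => ?_
  rw [← map_pow, mul_comm, ← Algebra.smul_def]
  exact W.smul_mem _ (hp m)

variable {K : Type*} [Field K] [CharZero K] [Algebra K A] {W : Submodule K A} {p : A[X]}

theorem eval_derivative_mem (hp : ∀ s : K, p.eval (algebraMap K A s) ∈ W) (s : K) :
    p.derivative.eval (algebraMap K A s) ∈ W := by
  refine eval_mem_of_forall_coeff_mem (fun m => ?_) s
  rw [coeff_derivative, mul_comm, ← Nat.cast_succ, ← nsmul_eq_mul]
  exact W.smul_of_tower_mem _ (coeff_mem_of_forall_eval_mem hp (m + 1))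

theorem eval_sub_coeff_zero_mem (hp : ∀ s : K, p.derivative.eval (algebraMap K A s) ∈ W) (s : K) :
    p.eval (algebraMap K A s) - p.coeff 0 ∈ W := by
  have higher_coeff (m : ℕ) : p.coeff (m + 1) ∈ W := by
    have hm := coeff_mem_of_forall_eval_mem hp m
    rw [coeff_derivative, mul_comm, ← Nat.cast_succ, ← map_natCast (algebraMap K A),
      ← Algebra.smul_def] at hm
    exact (W.smul_mem_iff (Nat.cast_ne_zero.2 m.succ_ne_zero)).1 hm
  have hq := eval_mem_of_forall_coeff_mem (p := p - C (p.coeff 0)) (W := W) (fun m => ?_) s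
  · rwa [eval_sub, eval_C] at hq
  · cases m with
    | zero => rw [coeff_sub, coeff_C_zero, sub_self]; exact W.zero_mem
    | succ m => rw [coeff_sub, coeff_C_succ, sub_zero]; exact higher_coeff m

/-- `L_s` as a polynomial in `s`. -/
noncomputable def pencilPolynomial : (CanonicalSpace → ℝ)[X] :=
  C hilbertM + C hilbertQ * X + C hilbertN * X ^ 2

theorem eval_pencilPolynomial (s : ℝ) :
    pencilPolynomial.eval (algebraMap ℝ (CanonicalSpace → ℝ) s) = pencil s := by
  simp only [pencilPolynomial, eval_add, eval_mul, eval_C, eval_X, eval_pow, ← map_pow,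
    mul_comm _ (algebraMap _ _ _), ← Algebra.smul_def, pencil]

theorem derivative_pencilPolynomial :
    derivative pencilPolynomial = C hilbertQ + C (2 * hilbertN) * X := by
  simp only [pencilPolynomial, derivative_add, derivative_mul, derivative_C, derivative_X,
    derivative_X_pow, C_mul, C_ofNat, Nat.cast_ofNat]
  ring

theorem eval_derivative_pencilPolynomial (s : ℝ) :
    (derivative pencilPolynomial).eval (algebraMap ℝ (CanonicalSpace → ℝ) s) = pencilDeriv s := by
  rw [derivative_pencilPolynomial, pencilDeriv, eval_add, eval_mul, eval_C, eval_C, eval_X,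
    Algebra.smul_def, map_mul, map_ofNat]
  ring

theorem coeff_zero_pencilPolynomial : pencilPolynomial.coeff 0 = hilbertM := by
  simp [pencilPolynomial]

theorem derivative_pencilPolynomial_sq :
    derivative pencilPolynomial ^ 2 = C (4 * hilbertN) * pencilPolynomial - C (hilbertS ^ 2) := by
  have hQ : C hilbertQ ^ 2 = 4 * C hilbertM * C hilbertN - C (hilbertS ^ 2) := by
    rw [← C_pow, hilbertQ_sq, C_sub, C_mul, C_mul, C_ofNat]
  rw [derivative_pencilPolynomial, pencilPolynomial, C_mul, C_mul, C_ofNat, C_ofNat]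
  linear_combination hQ

theorem derivative_derivative_pencilPolynomial :
    derivative (derivative pencilPolynomial) = C (2 * hilbertN) := by
  rw [derivative_pencilPolynomial]
  simp

/-- The span of the products `L_s ^ i * S ^ j` with `i + j = k`. -/
noncomputable def pencilSpan (k : ℕ) : Submodule ℝ (CanonicalSpace → ℝ) :=
  Submodule.span ℝ {f | ∃ s i j, i + j = k ∧ f = pencil s ^ i * hilbertS ^ j}

theorem eval_mem_pencilSpan (i j : ℕ) (s : ℝ) :
    (pencilPolynomial ^ i * C (hilbertS ^ j)).eval (algebraMap ℝ _ s) ∈ pencilSpan (i + j) := by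
  rw [eval_mul, eval_pow, eval_C, eval_pencilPolynomial]
  exact Submodule.subset_span ⟨s, i, j, rfl, rfl⟩

theorem pencil_mul_deriv_mem_pencilSpan (s : ℝ) (i j : ℕ) :
    pencil s ^ i * hilbertS ^ j * pencilDeriv s ∈ pencilSpan (i + 1 + j) := by
  have h := eval_derivative_mem (eval_mem_pencilSpan (i + 1) j) s
  rw [derivative_mul, derivative_C, mul_zero, add_zero, derivative_pow_succ, eval_mul, eval_mul,
    eval_mul, eval_pow, eval_C, eval_C, eval_pencilPolynomial, eval_derivative_pencilPolynomial]
    at h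
  refine ((pencilSpan _).smul_mem_iff (Nat.cast_add_one_ne_zero (R := ℝ) i)).1 ?_
  convert h using 1
  rw [Algebra.smul_def, map_add, map_natCast, map_one]
  ring

/-- The discriminant of the pencil in `s` is `-S²`, which makes its powers closed under second
derivatives up to the factors `N` and `S²`. -/
theorem derivative_derivative_pencilPolynomial_pow (i : ℕ) :
    derivative (derivative (pencilPolynomial ^ (i + 1))) =
      (i + 1) * ((4 * i + 2) * C hilbertN * pencilPolynomial ^ i
        - i * C (hilbertS ^ 2) * pencilPolynomial ^ (i - 1)) := by
  have lower_power : (i : (CanonicalSpace → ℝ)[X]) * pencilPolynomial ^ (i - 1) * pencilPolynomial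
      = i * pencilPolynomial ^ i := by
    cases i with
    | zero => simp
    | succ i => rw [Nat.add_sub_cancel, mul_assoc, pow_succ]
  rw [derivative_pow_succ, derivative_mul, derivative_mul, derivative_pow, derivative_C, zero_mul,
    derivative_derivative_pencilPolynomial, C_mul, C_ofNat, C_add, C_1, map_natCast]
  have square := derivative_pencilPolynomial_sq
  rw [C_mul, C_ofNat] at square
  linear_combination (i + 1) * i * pencilPolynomial ^ (i - 1) * square
    + 4 * (i + 1) * C hilbertN * lower_power

theorem pencil_mul_hilbertN_mem_pencilSpan (s : ℝ) (i j : ℕ) :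
    pencil s ^ i * hilbertS ^ j * hilbertN ∈ pencilSpan (i + 1 + j) := by
  have second_derivative := eval_derivative_mem
    (eval_derivative_mem (eval_mem_pencilSpan (i + 1) j)) s
  rw [derivative_mul, derivative_C, mul_zero, add_zero, derivative_mul, derivative_C, mul_zero,
    add_zero, derivative_derivative_pencilPolynomial_pow] at second_derivative
  simp only [eval_mul, eval_add, eval_sub, eval_pow, eval_C, eval_natCast, eval_ofNat, eval_one,
    eval_pencilPolynomial] at second_derivative
  have lower_power :
      (i : ℝ) • (pencil s ^ (i - 1) * hilbertS ^ (j + 2)) ∈ pencilSpan (i + 1 + j) := by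
    cases i with
    | zero => rw [Nat.cast_zero, zero_smul]; exact zero_mem _
    | succ i => exact Submodule.smul_mem _ _ (Submodule.subset_span ⟨s, i, j + 2, by lia, rfl⟩)
  have hi : ((i + 1) * (4 * i + 2) : ℝ) ≠ 0 := by positivity
  refine ((pencilSpan _).smul_mem_iff hi).1 ?_
  convert add_mem second_derivative (Submodule.smul_mem _ (i + 1 : ℝ) lower_power) using 1
  simp only [Algebra.smul_def, map_mul, map_add, map_natCast, map_ofNat, map_one]
  ring

theorem pencil_mul_mem_pencilSpan (s : ℝ) (i j : ℕ) {f : CanonicalSpace → ℝ}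
    (hf : f ∈ invariantForms) : pencil s ^ i * hilbertS ^ j * f ∈ pencilSpan (i + 1 + j) := by
  suffices Submodule.span ℝ {pencil s, pencilDeriv s, hilbertN, hilbertS} ≤
      (pencilSpan (i + 1 + j)).comap (LinearMap.mulLeft ℝ (pencil s ^ i * hilbertS ^ j)) from
    this (invariantForms_le_span_pencil s hf)
  rw [Submodule.span_le]
  rintro _ (rfl | rfl | rfl | rfl)
  · exact Submodule.subset_span ⟨s, i + 1, j, rfl, by simp only [LinearMap.mulLeft_apply]; ring⟩
  · exact pencil_mul_deriv_mem_pencilSpan s i j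
  · exact pencil_mul_hilbertN_mem_pencilSpan s i j
  · exact Submodule.subset_span ⟨s, i, j + 1, by lia, by simp only [LinearMap.mulLeft_apply]; ring⟩

theorem pow_invariantForms_le_pencilSpan (k : ℕ) : invariantForms ^ k ≤ pencilSpan k := by
  induction k with
  | zero =>
    rw [pow_zero, Submodule.one_eq_span, Submodule.span_singleton_le_iff_mem]
    exact Submodule.subset_span ⟨0, 0, 0, rfl, by simp⟩
  | succ k ih =>
    rw [pow_succ, Submodule.mul_le]
    intro f hf g hg
    suffices pencilSpan k ≤ (pencilSpan (k + 1)).comap (LinearMap.mulRight ℝ g) from this (ih hf)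
    refine Submodule.span_le.2 ?_
    rintro _ ⟨s, i, j, rfl, rfl⟩
    exact add_right_comm i j 1 ▸ pencil_mul_mem_pencilSpan s i j hg

/-- The forms `L_s ^ i * L_s' * S ^ j` of degree `2 * k`, which are the Poisson brackets of `N` with
the forms `L_s ^ (i + 1) * S ^ j` up to constants: their span is the image of the homological
operator `{N, ·}`. -/
noncomputable def homologicalImage (k : ℕ) : Submodule ℝ (CanonicalSpace → ℝ) :=
  Submodule.span ℝ {f | ∃ s i j, i + 1 + j = k ∧ f = pencil s ^ i * pencilDeriv s * hilbertS ^ j}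

/-- The forms of degree `2 * k` in `M` and `S` alone, which the normal form retains. -/
noncomputable def normalForms (k : ℕ) : Submodule ℝ (CanonicalSpace → ℝ) :=
  Submodule.span ℝ (range fun i : Fin (k + 1) => hilbertM ^ (i : ℕ) * hilbertS ^ (k - i))

theorem pow_invariantForms_le_sup (k : ℕ) :
    invariantForms ^ k ≤ homologicalImage k ⊔ normalForms k := by
  refine (pow_invariantForms_le_pencilSpan k).trans (Submodule.span_le.2 ?_)
  rintro _ ⟨s, i, j, rfl, rfl⟩
  have derivative_mem (s : ℝ) : (derivative (pencilPolynomial ^ i * C (hilbertS ^ j))).eval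
      (algebraMap ℝ _ s) ∈ homologicalImage (i + j) := by
    rw [derivative_mul, derivative_C, mul_zero, add_zero]
    cases i with
    | zero => simp
    | succ i =>
      rw [derivative_pow_succ, eval_mul, eval_mul, eval_mul, eval_pow, eval_C, eval_C,
        eval_pencilPolynomial, eval_derivative_pencilPolynomial]
      convert (homologicalImage _).smul_mem (i + 1 : ℝ)
        (Submodule.subset_span ⟨s, i, j, rfl, rfl⟩) using 1
      rw [Algebra.smul_def, map_add, map_natCast, map_one]
      ring
  have difference_mem := eval_sub_coeff_zero_mem derivative_mem s
  rw [mul_coeff_zero, coeff_C_zero, coeff_zero_eq_eval_zero, eval_pow, ← coeff_zero_eq_eval_zero,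
    coeff_zero_pencilPolynomial, eval_mul, eval_pow, eval_C, eval_pencilPolynomial]
    at difference_mem
  have normal_mem : hilbertM ^ i * hilbertS ^ j ∈ normalForms (i + j) :=
    Submodule.subset_span ⟨⟨i, by lia⟩, by simp⟩
  exact sub_add_cancel (pencil s ^ i * hilbertS ^ j) (hilbertM ^ i * hilbertS ^ j) ▸
    Submodule.add_mem_sup difference_mem normal_mem

end PolynomialPencils

theorem homologicalImage_apply_q_axis {k : ℕ} {d : CanonicalSpace → ℝ}
    (hd : d ∈ homologicalImage k) : d ![1, 0, 0, 0] = 0 := by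
  have hle : homologicalImage k ≤
      LinearMap.ker (LinearMap.proj (R := ℝ) (φ := fun _ : CanonicalSpace => ℝ) ![1, 0, 0, 0]) := by
    refine Submodule.span_le.2 ?_
    rintro _ ⟨s, i, j, -, rfl⟩
    simp [pencilDeriv, hilbertQ, hilbertN]
  exact hle hd

/-! ### Symplectic maps generated by functions of the invariants -/

/-- A smooth injective map of `ℝ⁴` that fixes the origin and preserves the standard symplectic
form. -/
structure IsSymplecticMap (Φ : CanonicalSpace → CanonicalSpace) : Prop where
  contDiff : ContDiff ℝ ∞ Φ
  injective : Function.Injective Φ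
  map_zero : Φ 0 = 0
  symplectic : ∀ u a b : CanonicalSpace,
    standardForm (fderiv ℝ Φ u a) (fderiv ℝ Φ u b) = standardForm a b

namespace IsSymplecticMap

variable {Φ Ψ : CanonicalSpace → CanonicalSpace}

theorem differentiable (h : IsSymplecticMap Φ) : Differentiable ℝ Φ :=
  h.contDiff.differentiable (by simp)

theorem comp (hΦ : IsSymplecticMap Φ) (hΨ : IsSymplecticMap Ψ) : IsSymplecticMap (Φ ∘ Ψ) where
  contDiff := hΦ.contDiff.comp hΨ.contDiff
  injective := hΦ.injective.comp hΨ.injective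
  map_zero := by rw [Function.comp_apply, hΨ.map_zero, hΦ.map_zero]
  symplectic u a b := by
    rw [fderiv_comp u (hΦ.differentiable _) (hΨ.differentiable u),
      ContinuousLinearMap.comp_apply, ContinuousLinearMap.comp_apply, hΦ.symplectic,
      hΨ.symplectic]

theorem of_linear {T : CanonicalSpace →L[ℝ] CanonicalSpace} (hT : Function.Injective T)
    (h : ∀ a b, standardForm (T a) (T b) = standardForm a b) : IsSymplecticMap T where
  contDiff := T.contDiff
  injective := hT
  map_zero := T.map_zero
  symplectic u a b := by rw [T.fderiv]; exact h a b

theorem comp_mem_vanishing (h : IsSymplecticMap Φ) {k : ℕ} {F : CanonicalSpace → ℝ}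
    (hF : F ∈ vanishing k) : F ∘ Φ ∈ vanishing k :=
  _root_.comp_mem_vanishing hF h.map_zero h.differentiable.differentiableAt

end IsSymplecticMap

/-- The linear shear `(q, p) ↦ (q + s p, p)`. -/
noncomputable def shear (s : ℝ) : CanonicalSpace →L[ℝ] CanonicalSpace :=
  LinearMap.toContinuousLinearMap
    { toFun := fun u => ![u 0 + s * u 2, u 1 + s * u 3, u 2, u 3]
      map_add' := fun u v => by
        ext i; fin_cases i <;> simp <;> ring
      map_smul' := fun c u => by
        ext i; fin_cases i <;> simp <;> ring }

theorem shear_apply (s : ℝ) (u : CanonicalSpace) :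
    shear s u = ![u 0 + s * u 2, u 1 + s * u 3, u 2, u 3] := rfl

theorem shear_neg_shear (s : ℝ) (u : CanonicalSpace) : shear (-s) (shear s u) = u := by
  ext i; fin_cases i <;> simp [shear_apply]

theorem shear_shear_neg (s : ℝ) (u : CanonicalSpace) : shear s (shear (-s) u) = u := by
  simpa only [neg_neg] using shear_neg_shear (-s) u

theorem isSymplecticMap_shear (s : ℝ) : IsSymplecticMap (shear s) :=
  .of_linear (Function.LeftInverse.injective (shear_neg_shear s))
    fun a b => by simp only [standardForm, shear_apply, Matrix.cons_val]; ring

theorem hilbertM_shear (s : ℝ) (u : CanonicalSpace) : hilbertM (shear s u) = pencil s u := by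
  simp only [hilbertM, pencil, hilbertQ, hilbertN, shear_apply, Matrix.cons_val, Pi.add_apply,
    Pi.smul_apply, smul_eq_mul]
  ring

theorem hilbertQ_shear (s : ℝ) (u : CanonicalSpace) : hilbertQ (shear s u) = pencilDeriv s u := by
  simp only [pencilDeriv, hilbertQ, hilbertN, shear_apply, Matrix.cons_val, Pi.add_apply,
    Pi.smul_apply, smul_eq_mul]
  ring

theorem hilbertN_shear (s : ℝ) (u : CanonicalSpace) : hilbertN (shear s u) = hilbertN u := by
  simp [hilbertN, shear_apply]

theorem hilbertS_shear (s : ℝ) (u : CanonicalSpace) : hilbertS (shear s u) = hilbertS u := by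
  simp only [hilbertS, shear_apply, Matrix.cons_val]
  ring

/-- The simultaneous rotation of `q` and `p` by the angle `θ`, the flow of `S` up to sign. -/
noncomputable def rotate (θ : ℝ) (u : CanonicalSpace) : CanonicalSpace :=
  ![Real.cos θ * u 0 - Real.sin θ * u 1, Real.sin θ * u 0 + Real.cos θ * u 1,
    Real.cos θ * u 2 - Real.sin θ * u 3, Real.sin θ * u 2 + Real.cos θ * u 3]

/-- The map `(q, p) ↦ (q, p - κ q)`, the flow of `M`. -/
def kick (κ : ℝ) (u : CanonicalSpace) : CanonicalSpace :=
  ![u 0, u 1, u 2 - κ * u 0, u 3 - κ * u 1]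

theorem rotate_neg_rotate (θ : ℝ) (u : CanonicalSpace) : rotate (-θ) (rotate θ u) = u := by
  have h := Real.sin_sq_add_cos_sq θ
  ext i
  fin_cases i <;> simp [rotate]
  · linear_combination u 0 * h
  · linear_combination u 1 * h
  · linear_combination u 2 * h
  · linear_combination u 3 * h

theorem kick_neg_kick (κ : ℝ) (u : CanonicalSpace) : kick (-κ) (kick κ u) = u := by
  ext i; fin_cases i <;> simp [kick]

theorem standardForm_rotate (θ : ℝ) (a b : CanonicalSpace) :
    standardForm (rotate θ a) (rotate θ b) = standardForm a b := by
  simp only [standardForm, rotate, Matrix.cons_val]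
  linear_combination (a 0 * b 2 - a 2 * b 0 + (a 1 * b 3 - a 3 * b 1)) * Real.sin_sq_add_cos_sq θ

/-- The map `(q, p) ↦ (R q, R (p - κ q))` where `κ = ∂₁f(M, S)` and `R` is the rotation by the angle
`θ = ∂₂f(M, S)`: the time-one map of the Hamiltonian flow of `f(M, S)`, up to the sign of `θ`. -/
noncomputable def twist (f : ℝ × ℝ → ℝ) (u : CanonicalSpace) : CanonicalSpace :=
  rotate (fderiv ℝ f (hilbertM u, hilbertS u) (0, 1))
    (kick (fderiv ℝ f (hilbertM u, hilbertS u) (1, 0)) u)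

theorem hilbertM_rotate_kick (θ κ : ℝ) (u : CanonicalSpace) :
    hilbertM (rotate θ (kick κ u)) = hilbertM u := by
  simp only [hilbertM, rotate, kick, Matrix.cons_val]
  linear_combination (u 0 ^ 2 + u 1 ^ 2) / 2 * Real.sin_sq_add_cos_sq θ

theorem hilbertS_rotate_kick (θ κ : ℝ) (u : CanonicalSpace) :
    hilbertS (rotate θ (kick κ u)) = hilbertS u := by
  simp only [hilbertS, rotate, kick, Matrix.cons_val]
  linear_combination (u 0 * u 3 - u 1 * u 2) * Real.sin_sq_add_cos_sq θ

theorem hilbertN_rotate_kick (θ κ : ℝ) (u : CanonicalSpace) :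
    hilbertN (rotate θ (kick κ u)) = hilbertN u - κ * hilbertQ u + κ ^ 2 * hilbertM u := by
  simp only [hilbertN, hilbertQ, hilbertM, rotate, kick, Matrix.cons_val]
  linear_combination ((u 2 - κ * u 0) ^ 2 + (u 3 - κ * u 1) ^ 2) / 2 * Real.sin_sq_add_cos_sq θ

theorem hilbertQ_rotate_kick (θ κ : ℝ) (u : CanonicalSpace) :
    hilbertQ (rotate θ (kick κ u)) = hilbertQ u - 2 * κ * hilbertM u := by
  simp only [hilbertQ, hilbertM, rotate, kick, Matrix.cons_val]
  linear_combination (u 0 * (u 2 - κ * u 0) + u 1 * (u 3 - κ * u 1)) * Real.sin_sq_add_cos_sq θ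

theorem twist_injective (f : ℝ × ℝ → ℝ) : Function.Injective (twist f) := by
  intro u v h
  have hM : hilbertM u = hilbertM v := by
    simpa only [twist, hilbertM_rotate_kick] using congrArg hilbertM h
  have hS : hilbertS u = hilbertS v := by
    simpa only [twist, hilbertS_rotate_kick] using congrArg hilbertS h
  rw [twist, twist, hM, hS] at h
  exact Function.LeftInverse.injective (kick_neg_kick _)
    (Function.LeftInverse.injective (rotate_neg_rotate _) h)

theorem contDiff_hilbertM : ContDiff ℝ ∞ hilbertM := by unfold hilbertM; fun_prop

theorem contDiff_hilbertS : ContDiff ℝ ∞ hilbertS := by unfold hilbertS; fun_prop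

theorem contDiff_rotate_kick {κ θ : CanonicalSpace → ℝ} (hκ : ContDiff ℝ ∞ κ)
    (hθ : ContDiff ℝ ∞ θ) : ContDiff ℝ ∞ fun u => rotate (θ u) (kick (κ u) u) := by
  rw [contDiff_pi]
  intro i
  fin_cases i <;> simp only [rotate, kick, Fin.reduceFinMk, Matrix.cons_val] <;> fun_prop

theorem hasFDerivAt_coord (i : Fin 4) {u : CanonicalSpace} :
    HasFDerivAt (fun v : CanonicalSpace => v i)
      (ContinuousLinearMap.proj (R := ℝ) (φ := fun _ : Fin 4 => ℝ) i) u :=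
  (ContinuousLinearMap.proj (R := ℝ) (φ := fun _ : Fin 4 => ℝ) i).hasFDerivAt

theorem fderiv_hilbertM_apply (u a : CanonicalSpace) :
    fderiv ℝ hilbertM u a = u 0 * a 0 + u 1 * a 1 := by
  have h := (((hasFDerivAt_coord (u := u) 0).pow 2).add ((hasFDerivAt_coord 1).pow 2)).mul_const
    2⁻¹
  exact (DFunLike.congr_fun h.fderiv a).trans (by simp; ring)

theorem fderiv_hilbertS_apply (u a : CanonicalSpace) :
    fderiv ℝ hilbertS u a = u 0 * a 3 + u 3 * a 0 - (u 1 * a 2 + u 2 * a 1) := by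
  have h := ((hasFDerivAt_coord (u := u) 0).mul (hasFDerivAt_coord 3)).sub
    ((hasFDerivAt_coord 1).mul (hasFDerivAt_coord 2))
  exact (DFunLike.congr_fun h.fderiv a).trans (by simp)

theorem fderiv_rotate_kick {κ θ : CanonicalSpace → ℝ} {u : CanonicalSpace}
    (hκ : DifferentiableAt ℝ κ u) (hθ : DifferentiableAt ℝ θ u) (a : CanonicalSpace) :
    fderiv ℝ (fun v => rotate (θ v) (kick (κ v) v)) u a =
      rotate (θ u) (kick (κ u) a - fderiv ℝ κ u a • ![0, 0, u 0, u 1]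
        + fderiv ℝ θ u a • ![-u 1, u 0, -(u 3 - κ u * u 1), u 2 - κ u * u 0]) := by
  have cosine := hθ.hasFDerivAt.cos
  have sine := hθ.hasFDerivAt.sin
  have momentum (i j : Fin 4) :=
    (hasFDerivAt_coord i).sub (hκ.hasFDerivAt.mul (hasFDerivAt_coord j))
  have components (i : Fin 4) : DifferentiableAt ℝ (fun v => rotate (θ v) (kick (κ v) v) i) u := by
    fin_cases i <;> simp only [rotate, kick, Fin.reduceFinMk, Matrix.cons_val] <;> fun_prop
  rw [fderiv_pi components]
  ext i
  fin_cases i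
  · exact (DFunLike.congr_fun
      ((cosine.mul (hasFDerivAt_coord 0)).sub (sine.mul (hasFDerivAt_coord 1))).fderiv a).trans
      (by simp [rotate, kick]; ring)
  · exact (DFunLike.congr_fun
      ((sine.mul (hasFDerivAt_coord 0)).add (cosine.mul (hasFDerivAt_coord 1))).fderiv a).trans
      (by simp [rotate, kick]; ring)
  · exact (DFunLike.congr_fun
      ((cosine.mul (momentum 2 0)).sub (sine.mul (momentum 3 1))).fderiv a).trans
      (by simp [rotate, kick]; ring)
  · exact (DFunLike.congr_fun
      ((sine.mul (momentum 2 0)).add (cosine.mul (momentum 3 1))).fderiv a).trans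
      (by simp [rotate, kick]; ring)

theorem contDiff_partial {f : ℝ × ℝ → ℝ} (hf : ContDiff ℝ ∞ f) (e : ℝ × ℝ) :
    ContDiff ℝ ∞ fun u => fderiv ℝ f (hilbertM u, hilbertS u) e :=
  ((hf.fderiv_right (m := ∞) (by simp)).clm_apply contDiff_const).comp
    (contDiff_hilbertM.prodMk contDiff_hilbertS)

theorem fderiv_partial {f : ℝ × ℝ → ℝ} (hf : ContDiff ℝ ∞ f) (e : ℝ × ℝ) (u a : CanonicalSpace) :
    fderiv ℝ (fun v => fderiv ℝ f (hilbertM v, hilbertS v) e) u a =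
      fderiv ℝ hilbertM u a * fderiv ℝ (fderiv ℝ f) (hilbertM u, hilbertS u) (1, 0) e
        + fderiv ℝ hilbertS u a * fderiv ℝ (fderiv ℝ f) (hilbertM u, hilbertS u) (0, 1) e := by
  have outer := (((hf.fderiv_right (m := ∞) (by simp)).differentiable (by simp))
    (hilbertM u, hilbertS u)).hasFDerivAt
  have inner := ((contDiff_hilbertM.differentiable (by simp)) u).hasFDerivAt.prodMk
    ((contDiff_hilbertS.differentiable (by simp)) u).hasFDerivAt
  have h := (outer.comp u inner).clm_apply (hasFDerivAt_const e u)
  have split (x y : ℝ) : ((x, y) : ℝ × ℝ) = x • (1, 0) + y • (0, 1) := by simp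
  refine (DFunLike.congr_fun h.fderiv a).trans ?_
  simp only [ContinuousLinearMap.comp_zero, zero_add, ContinuousLinearMap.flip_apply,
    ContinuousLinearMap.comp_apply, ContinuousLinearMap.prod_apply]
  rw [split (fderiv ℝ hilbertM u a), map_add, map_smul, map_smul]
  simp only [add_apply, smul_apply, smul_eq_mul]

/-- The map is symplectic because `dκ ∧ dM + dθ ∧ dS = d(κ dM + θ dS) = d(df) = 0`. -/
theorem standardForm_fderiv_twist {f : ℝ × ℝ → ℝ} (hf : ContDiff ℝ ∞ f) (u a b : CanonicalSpace) :
    standardForm (fderiv ℝ (twist f) u a) (fderiv ℝ (twist f) u b) = standardForm a b := by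
  have symmetry := (hf.contDiffAt (x := (hilbertM u, hilbertS u))).isSymmSndFDerivAt
    (by simpa using ENat.LEInfty.out) |>.eq (1, 0) (0, 1)
  have derivative (a : CanonicalSpace) := fderiv_rotate_kick
    ((contDiff_partial hf (1, 0)).differentiable (by simp) u)
    ((contDiff_partial hf (0, 1)).differentiable (by simp) u) a
  change standardForm (fderiv ℝ (fun v => rotate _ (kick _ v)) u a)
    (fderiv ℝ (fun v => rotate _ (kick _ v)) u b) = _
  rw [derivative, derivative, standardForm_rotate]
  simp only [fderiv_partial hf, fderiv_hilbertM_apply, fderiv_hilbertS_apply]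
  simp [standardForm, kick, symmetry]
  ring

theorem isSymplecticMap_twist {f : ℝ × ℝ → ℝ} (hf : ContDiff ℝ ∞ f) :
    IsSymplecticMap (twist f) where
  contDiff := contDiff_rotate_kick (contDiff_partial hf (1, 0)) (contDiff_partial hf (0, 1))
  injective := twist_injective f
  map_zero := by simp [twist, rotate, kick]
  symplectic := standardForm_fderiv_twist hf

/-- `Φ` acts on the invariants as the time-one map of a Hamiltonian that is a function of `L_s` and
`S` with derivative `κ` with respect to `L_s`. -/
structure IsPencilFlow (s : ℝ) (κ : CanonicalSpace → ℝ) (Φ : CanonicalSpace → CanonicalSpace) :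
    Prop extends IsSymplecticMap Φ where
  pencil_comp : pencil s ∘ Φ = pencil s
  pencilDeriv_comp : pencilDeriv s ∘ Φ = pencilDeriv s - 2 * κ * pencil s
  hilbertN_comp : hilbertN ∘ Φ = hilbertN - κ * pencilDeriv s + κ ^ 2 * pencil s
  hilbertS_comp : hilbertS ∘ Φ = hilbertS

theorem exists_isPencilFlow {f : ℝ × ℝ → ℝ} (hf : ContDiff ℝ ∞ f) (s : ℝ) :
    ∃ Φ, IsPencilFlow s (fun u => fderiv ℝ f (pencil s u, hilbertS u) (1, 0)) Φ := by
  refine ⟨shear (-s) ∘ twist f ∘ shear s,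
    (isSymplecticMap_shear (-s)).comp ((isSymplecticMap_twist hf).comp (isSymplecticMap_shear s)),
    ?_, ?_, ?_, ?_⟩ <;> funext u
  · simp only [Function.comp_apply, ← hilbertM_shear, shear_shear_neg, twist, hilbertM_rotate_kick]
  · simp only [Function.comp_apply, Pi.sub_apply, Pi.mul_apply, Pi.ofNat_apply, ← hilbertM_shear,
      ← hilbertQ_shear, shear_shear_neg, twist, hilbertQ_rotate_kick, hilbertS_shear]
  · simp only [Function.comp_apply, Pi.sub_apply, Pi.add_apply, Pi.mul_apply, Pi.pow_apply,
      ← hilbertM_shear, ← hilbertQ_shear, hilbertN_shear, twist, hilbertN_rotate_kick,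
      hilbertS_shear]
  · simp only [Function.comp_apply, hilbertS_shear, twist, hilbertS_rotate_kick]

theorem exists_isPencilFlow_monomial (s c : ℝ) (i j : ℕ) :
    ∃ Φ, IsPencilFlow s (c • (pencil s ^ i * hilbertS ^ j)) Φ := by
  let f : ℝ × ℝ → ℝ := fun p => c / (i + 1) * (p.1 ^ (i + 1) * p.2 ^ j)
  have hf : ContDiff ℝ ∞ f := by fun_prop
  have partial_deriv (p : ℝ × ℝ) : fderiv ℝ f p (1, 0) = c * (p.1 ^ i * p.2 ^ j) := by
    have h := (((hasFDerivAt_fst (𝕜 := ℝ) (p := p)).pow (i + 1)).mul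
      ((hasFDerivAt_snd (p := p)).pow j)).const_mul (c / (i + 1))
    refine (DFunLike.congr_fun h.fderiv (1, 0)).trans ?_
    simp only [nsmul_eq_mul, add_tsub_cancel_right, Nat.cast_add, Nat.cast_one, smul_add, add_apply,
      smul_apply, ContinuousLinearMap.coe_snd', ContinuousLinearMap.coe_fst', smul_eq_mul, mul_zero,
      mul_one, zero_add]
    field_simp
  obtain ⟨Φ, hΦ⟩ := exists_isPencilFlow hf s
  refine ⟨Φ, ?_⟩
  convert hΦ using 1
  funext u
  exact (partial_deriv (pencil s u, hilbertS u)).symm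

/-! ### Normal form of invariant Hamiltonians -/

section GradedPerturbation

variable {k : ℕ} {Φ : CanonicalSpace → CanonicalSpace} {G : Set (CanonicalSpace → ℝ)}

theorem comp_sub_mem_of_mem_pow (hG : invariantForms ≤ Submodule.span ℝ G)
    (hΦ : ∀ v ∈ G, v ∘ Φ - v ∈ invariantsFrom (k + 1)) {l : ℕ} {f : CanonicalSpace → ℝ}
    (hf : f ∈ invariantForms ^ l) : f ∘ Φ - f ∈ invariantsFrom (l + k) := by
  have generator (v : CanonicalSpace → ℝ) (hv : v ∈ invariantForms) :
      v ∘ Φ - v ∈ invariantsFrom (k + 1) := by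
    suffices Submodule.span ℝ G ≤ (invariantsFrom (k + 1)).comap
      (LinearMap.funLeft ℝ ℝ Φ - LinearMap.id) from this (hG hv)
    exact Submodule.span_le.2 hΦ
  induction l generalizing f with
  | zero =>
    rw [pow_zero] at hf
    obtain ⟨c, rfl⟩ := Submodule.mem_one.1 hf
    exact (sub_self _ : _ = (0 : CanonicalSpace → ℝ)) ▸ zero_mem _
  | succ l ih =>
    rw [pow_succ] at hf
    refine Submodule.mul_induction_on hf (fun g hg v hv => ?_) fun f g hf hg => ?_
    · have comp_mem : v ∘ Φ ∈ invariantsFrom 1 := by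
        rw [← sub_add_cancel (v ∘ Φ) v]
        exact add_mem (invariantsFrom_antitone (by lia) (generator v hv))
          (pow_le_invariantsFrom le_rfl (by rwa [pow_one]))
      have product_rule : (g * v) ∘ Φ - g * v = (g ∘ Φ - g) * (v ∘ Φ) + g * (v ∘ Φ - v) := by
        rw [Pi.mul_comp]; ring
      rw [product_rule]
      refine add_mem ?_ ?_
      · exact (by ring : l + k + 1 = l + 1 + k) ▸ mul_mem_invariantsFrom (ih hg) comp_mem
      · exact (by ring : l + (k + 1) = l + 1 + k) ▸
          mul_mem_invariantsFrom (pow_le_invariantsFrom le_rfl hg) (generator v hv)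
    · rw [Pi.add_comp, add_sub_add_comm]
      exact add_mem hf hg

theorem comp_sub_mem_of_mem_invariantsFrom (hG : invariantForms ≤ Submodule.span ℝ G)
    (hΦ : ∀ v ∈ G, v ∘ Φ - v ∈ invariantsFrom (k + 1)) {m : ℕ} {f : CanonicalSpace → ℝ}
    (hf : f ∈ invariantsFrom m) : f ∘ Φ - f ∈ invariantsFrom (m + k) := by
  suffices invariantsFrom m ≤ (invariantsFrom (m + k)).comap
    (LinearMap.funLeft ℝ ℝ Φ - LinearMap.id) from this hf
  exact iSup_le fun l f hf =>
    invariantsFrom_antitone (by lia) (comp_sub_mem_of_mem_pow hG hΦ hf)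

end GradedPerturbation

theorem IsPencilFlow.comp_sub_mem {s : ℝ} {κ : CanonicalSpace → ℝ}
    {Φ : CanonicalSpace → CanonicalSpace} {k m : ℕ} (hΦ : IsPencilFlow s κ Φ)
    (hκ : κ ∈ invariantForms ^ k) {f : CanonicalSpace → ℝ} (hf : f ∈ invariantsFrom m) :
    f ∘ Φ - f ∈ invariantsFrom (m + k) := by
  have kick_mem {v : CanonicalSpace → ℝ} (hv : v ∈ invariantForms) :
      κ * v ∈ invariantsFrom (k + 1) :=
    pow_le_invariantsFrom le_rfl (pow_succ invariantForms k ▸ Submodule.mul_mem_mul hκ hv)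
  refine comp_sub_mem_of_mem_invariantsFrom (invariantForms_le_span_pencil s) ?_ hf
  rintro _ (rfl | rfl | rfl | rfl)
  · rw [hΦ.pencil_comp, sub_self]
    exact zero_mem _
  · rw [hΦ.pencilDeriv_comp, sub_sub_cancel_left, mul_assoc, two_mul]
    exact neg_mem (add_mem (kick_mem (pencil_mem s)) (kick_mem (pencil_mem s)))
  · have increment : hilbertN ∘ Φ - hilbertN = κ * (κ * pencil s) - κ * pencilDeriv s := by
      rw [hΦ.hilbertN_comp]; ring
    rw [increment]
    exact sub_mem (invariantsFrom_antitone (by lia) (mul_mem_invariantsFrom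
      (pow_le_invariantsFrom le_rfl hκ) (kick_mem (pencil_mem s)))) (kick_mem (pencilDeriv_mem s))
  · rw [hΦ.hilbertS_comp, sub_self]
    exact zero_mem _

/-- A symplectic map that preserves `S` and, on invariant polynomials, is the identity up to terms
of higher order. -/
structure IsNormalizingMap (Φ : CanonicalSpace → CanonicalSpace) : Prop extends
    IsSymplecticMap Φ where
  hilbertS_comp : hilbertS ∘ Φ = hilbertS
  comp_sub_mem : ∀ {m : ℕ} {f : CanonicalSpace → ℝ}, f ∈ invariantsFrom m →
    f ∘ Φ - f ∈ invariantsFrom (m + 1)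

theorem IsPencilFlow.isNormalizingMap {s : ℝ} {κ : CanonicalSpace → ℝ}
    {Φ : CanonicalSpace → CanonicalSpace} {k : ℕ} (hΦ : IsPencilFlow s κ Φ)
    (hκ : κ ∈ invariantForms ^ k) (hk : 1 ≤ k) : IsNormalizingMap Φ where
  toIsSymplecticMap := hΦ.toIsSymplecticMap
  hilbertS_comp := hΦ.hilbertS_comp
  comp_sub_mem hf := invariantsFrom_antitone (by lia) (hΦ.comp_sub_mem hκ hf)

namespace IsNormalizingMap

variable {Φ Ψ : CanonicalSpace → CanonicalSpace}

theorem comp_mem (hΦ : IsNormalizingMap Φ) {m : ℕ} {f : CanonicalSpace → ℝ}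
    (hf : f ∈ invariantsFrom m) : f ∘ Φ ∈ invariantsFrom m := by
  rw [← sub_add_cancel (f ∘ Φ) f]
  exact add_mem (invariantsFrom_antitone m.le_succ (hΦ.comp_sub_mem hf)) hf

theorem comp (hΦ : IsNormalizingMap Φ) (hΨ : IsNormalizingMap Ψ) : IsNormalizingMap (Φ ∘ Ψ) where
  toIsSymplecticMap := hΦ.toIsSymplecticMap.comp hΨ.toIsSymplecticMap
  hilbertS_comp := by rw [← Function.comp_assoc, hΦ.hilbertS_comp, hΨ.hilbertS_comp]
  comp_sub_mem {m f} hf := by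
    rw [← Function.comp_assoc, ← sub_add_sub_cancel _ (f ∘ Ψ)]
    exact add_mem (hΨ.comp_mem (hΦ.comp_sub_mem hf)) (hΨ.comp_sub_mem hf)

protected theorem id : IsNormalizingMap id where
  toIsSymplecticMap := .of_linear (T := .id ℝ _) Function.injective_id fun _ _ => rfl
  hilbertS_comp := rfl
  comp_sub_mem {m f} _ := by rw [Function.comp_id, sub_self]; exact zero_mem _

end IsNormalizingMap

theorem homologicalImage_le (k : ℕ) : homologicalImage k ≤ invariantForms ^ k := by
  refine Submodule.span_le.2 ?_
  rintro _ ⟨s, i, j, rfl, rfl⟩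
  rw [pow_add, pow_succ]
  exact Submodule.mul_mem_mul (Submodule.mul_mem_mul (Submodule.pow_mem_pow _ (pencil_mem s) i)
    (pencilDeriv_mem s)) (Submodule.pow_mem_pow _ hilbertS_mem j)

theorem normalForms_le (k : ℕ) : normalForms k ≤ invariantForms ^ k := by
  refine Submodule.span_le.2 ?_
  rintro _ ⟨i, rfl⟩
  have h := Submodule.mul_mem_mul (Submodule.pow_mem_pow _ hilbertM_mem i)
    (Submodule.pow_mem_pow _ hilbertS_mem (k - i))
  rwa [← pow_add, Nat.add_sub_cancel' (Nat.lt_succ_iff.1 i.2)] at h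

section NormalForm

variable (ρ n : ℝ)

theorem exists_comp_sub_mem_of_pencil (s c : ℝ) {i j : ℕ} (h : 1 ≤ i + j)
    {f : CanonicalSpace → ℝ} (hf : f ∈ invariantsFrom 2) :
    ∃ Φ, IsNormalizingMap Φ ∧ (ρ • hilbertS + n • hilbertN + f) ∘ Φ
      - (ρ • hilbertS + n • hilbertN + f
        + (n * c) • (pencil s ^ i * pencilDeriv s * hilbertS ^ j)) ∈
      invariantsFrom (i + 1 + j + 1) := by
  obtain ⟨Φ, hΦ⟩ := exists_isPencilFlow_monomial s (-c) i j
  set κ := -c • (pencil s ^ i * hilbertS ^ j) with hκ_def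
  have hκ : κ ∈ invariantForms ^ (i + j) := Submodule.smul_mem _ _ (pow_add invariantForms i j ▸
    Submodule.mul_mem_mul (Submodule.pow_mem_pow _ (pencil_mem s) i)
      (Submodule.pow_mem_pow _ hilbertS_mem j))
  refine ⟨Φ, hΦ.isNormalizingMap hκ h, ?_⟩
  have expansion : (ρ • hilbertS + n • hilbertN + f) ∘ Φ - (ρ • hilbertS + n • hilbertN + f
      + (n * c) • (pencil s ^ i * pencilDeriv s * hilbertS ^ j)) =
      n • (κ ^ 2 * pencil s) + (f ∘ Φ - f) := by
    rw [Pi.add_comp, Pi.add_comp, Pi.smul_comp, Pi.smul_comp, hΦ.hilbertS_comp, hΦ.hilbertN_comp,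
      hκ_def]
    simp only [Algebra.smul_def, map_neg, map_mul]
    ring
  have quadratic_mem : κ ^ 2 * pencil s ∈ invariantForms ^ ((i + j) * 2 + 1) := by
    rw [pow_succ, pow_mul]
    exact Submodule.mul_mem_mul (Submodule.pow_mem_pow _ hκ 2) (pencil_mem s)
  rw [expansion]
  exact add_mem (Submodule.smul_mem _ _ (pow_le_invariantsFrom (by lia) quadratic_mem))
    (invariantsFrom_antitone (by lia) (hΦ.comp_sub_mem hκ hf))

theorem exists_comp_sub_mem_of_homologicalImage {k : ℕ} (hk : 2 ≤ k) {f d : CanonicalSpace → ℝ}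
    (hf : f ∈ invariantsFrom 2) (hd : d ∈ homologicalImage k) :
    ∃ Φ, IsNormalizingMap Φ ∧ (ρ • hilbertS + n • hilbertN + f) ∘ Φ
      - (ρ • hilbertS + n • hilbertN + f + n • d) ∈ invariantsFrom (k + 1) := by
  set h := ρ • hilbertS + n • hilbertN
  suffices ∀ c : ℝ, ∀ f ∈ invariantsFrom 2, ∃ Φ, IsNormalizingMap Φ ∧
      (h + f) ∘ Φ - (h + f + (n * c) • d) ∈ invariantsFrom (k + 1) by
    simpa only [mul_one] using this 1 f hf
  clear f hf
  induction hd using Submodule.span_induction with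
  | mem d hd =>
    obtain ⟨s, i, j, rfl, rfl⟩ := hd
    exact fun c f hf => exists_comp_sub_mem_of_pencil ρ n s c (by lia) hf
  | zero =>
    exact fun c f _ => ⟨id, .id, by simp only [Function.comp_id, smul_zero, add_zero, sub_self,
      zero_mem]⟩
  | smul b d _ ih => simpa only [smul_smul, mul_assoc] using fun c => ih (c * b)
  | add d₁ d₂ hd₁ _ ih₁ ih₂ =>
    intro c f hf
    have hd₁' : (n * c) • d₁ ∈ invariantsFrom 2 :=
      Submodule.smul_mem _ _ (pow_le_invariantsFrom hk (homologicalImage_le k hd₁))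
    obtain ⟨Φ₁, hΦ₁, h₁⟩ := ih₁ c f hf
    obtain ⟨Φ₂, hΦ₂, h₂⟩ := ih₂ c (f + (n * c) • d₁) (add_mem hf hd₁')
    refine ⟨Φ₁ ∘ Φ₂, hΦ₁.comp hΦ₂, ?_⟩
    convert add_mem (hΦ₂.comp_mem h₁) h₂ using 1
    rw [Pi.sub_comp, smul_add, ← add_assoc, ← add_assoc, Function.comp_assoc]
    abel

theorem exists_comp_sub_mem_of_pow {n : ℝ} (hn : n ≠ 0) {k : ℕ} (hk : 2 ≤ k)
    {f g : CanonicalSpace → ℝ} (hg : g ∈ invariantsFrom 2) (hf : f ∈ invariantForms ^ k) :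
    ∃ Φ, IsNormalizingMap Φ ∧ ∃ ν ∈ normalForms k, ν ![1, 0, 0, 0] = f ![1, 0, 0, 0] ∧
      (ρ • hilbertS + n • hilbertN + (g + f)) ∘ Φ - (ρ • hilbertS + n • hilbertN + (g + ν)) ∈
        invariantsFrom (k + 1) := by
  obtain ⟨d, hd, ν, hν, rfl⟩ := Submodule.mem_sup.1 (pow_invariantForms_le_sup k hf)
  obtain ⟨Φ, hΦ, h⟩ := exists_comp_sub_mem_of_homologicalImage ρ n hk
    (add_mem hg (pow_le_invariantsFrom hk hf)) (Submodule.smul_mem _ (-n⁻¹) hd)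
  refine ⟨Φ, hΦ, ν, hν, ?_, ?_⟩
  · rw [Pi.add_apply, homologicalImage_apply_q_axis hd, zero_add]
  · convert h using 2
    rw [smul_smul, mul_neg, mul_inv_cancel₀ hn]
    module

theorem exists_normalForm {n : ℝ} (hn : n ≠ 0) {f₂ f₃ o : CanonicalSpace → ℝ}
    (hf₂ : f₂ ∈ invariantForms ^ 2) (hf₃ : f₃ ∈ invariantsFrom 3) (ho : o ∈ vanishing 7) :
    ∃ Φ, IsNormalizingMap Φ ∧ ∃ ν₂ ∈ normalForms 2, ∃ ν₃ ∈ normalForms 3,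
      ν₂ ![1, 0, 0, 0] = f₂ ![1, 0, 0, 0] ∧
      (ρ • hilbertS + n • hilbertN + f₂ + f₃ + o) ∘ Φ
        - (ρ • hilbertS + n • hilbertN + ν₂ + ν₃) ∈ vanishing 7 := by
  set h := ρ • hilbertS + n • hilbertN
  obtain ⟨Φ₁, hΦ₁, ν₂, hν₂, hν₂_apply, h₁⟩ := exists_comp_sub_mem_of_pow ρ hn le_rfl
    (invariantsFrom_antitone (by lia) hf₃) hf₂
  obtain ⟨g₃, hg₃, r, hr, h_split⟩ := Submodule.mem_sup.1
    (invariantsFrom_le_sup 3 (add_mem hf₃ h₁))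
  obtain ⟨Φ₂, hΦ₂, ν₃, hν₃, -, h₂⟩ := exists_comp_sub_mem_of_pow ρ hn (by lia)
    (pow_le_invariantsFrom le_rfl (normalForms_le 2 hν₂)) hg₃
  refine ⟨Φ₁ ∘ Φ₂, hΦ₁.comp hΦ₂, ν₂, hν₂, ν₃, hν₃, hν₂_apply, ?_⟩
  have first_step : (h + f₂ + f₃ + o) ∘ Φ₁ = (h + (ν₂ + g₃)) + r + o ∘ Φ₁ := by
    change g₃ + r = f₃ + ((h + (f₃ + f₂)) ∘ Φ₁ - (h + (f₃ + ν₂))) at h_split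
    rw [add_assoc h, add_comm f₂, Pi.add_comp, add_assoc h, add_assoc ν₂, h_split]
    abel
  have decomposition : (h + f₂ + f₃ + o) ∘ Φ₁ ∘ Φ₂ - (h + ν₂ + ν₃) =
      ((h + (ν₂ + g₃)) ∘ Φ₂ - (h + (ν₂ + ν₃))) + r ∘ Φ₂ + o ∘ Φ₁ ∘ Φ₂ := by
    rw [← Function.comp_assoc, first_step, Pi.add_comp, Pi.add_comp, Function.comp_assoc]
    abel
  have high_order : invariantsFrom 4 ≤ vanishing 7 :=
    (invariantsFrom_le_vanishing 4).trans (vanishing_antitone (by lia))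
  rw [decomposition]
  exact add_mem (add_mem (high_order h₂) (high_order (hΦ₂.comp_mem hr)))
    ((hΦ₁.comp hΦ₂).comp_mem_vanishing ho)

end NormalForm

theorem exists_eq_of_mem_normalForms_two {ν : CanonicalSpace → ℝ} (hν : ν ∈ normalForms 2)
    (h : ν ![1, 0, 0, 0] = 0) :
    ∃ a₄ a₅ : ℝ, ν = a₄ • (hilbertM * hilbertS) + a₅ • hilbertS ^ 2 := by
  obtain ⟨c, rfl⟩ := (Submodule.mem_span_range_iff_exists_fun ℝ).1 hν
  have expansion : ∑ i : Fin (2 + 1), c i • (hilbertM ^ (i : ℕ) * hilbertS ^ (2 - (i : ℕ))) =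
      c 2 • hilbertM ^ 2 + (c 1 • (hilbertM * hilbertS) + c 0 • hilbertS ^ 2) := by
    rw [Fin.sum_univ_three]
    simp
    abel
  rw [expansion] at h ⊢
  have hc : c 2 = 0 := by simpa [hilbertM, hilbertS] using h
  exact ⟨c 1, c 0, by rw [hc, zero_smul, zero_add]⟩

theorem exists_eq_of_mem_normalForms_three {ν : CanonicalSpace → ℝ} (hν : ν ∈ normalForms 3) :
    ∃ a₆ a₇ a₈ a₉ : ℝ, ν = a₆ • hilbertM ^ 3 + a₇ • (hilbertM ^ 2 * hilbertS)
      + a₈ • (hilbertM * hilbertS ^ 2) + a₉ • hilbertS ^ 3 := by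
  obtain ⟨c, rfl⟩ := (Submodule.mem_span_range_iff_exists_fun ℝ).1 hν
  refine ⟨c 3, c 2, c 1, c 0, ?_⟩
  rw [Fin.sum_univ_four]
  simp
  abel

theorem comp_q_axis_isBigO {k : ℕ} {F : CanonicalSpace → ℝ} (hF : F ∈ vanishing k) :
    (fun x : ℝ => F ![x, 0, 0, 0]) =O[𝓝 0] fun x => x ^ k := by
  have axis_isBigO : (fun x : ℝ => (![x, 0, 0, 0] : CanonicalSpace)) =O[𝓝 0] fun x => x :=
    IsBigO.of_bound' (.of_forall fun x => (pi_norm_le_iff_of_nonneg (norm_nonneg x)).2 fun i => by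
      fin_cases i <;> simp)
  exact (IsBigO.comp_tendsto hF (axis_isBigO.trans_tendsto Filter.tendsto_id)).trans
    (axis_isBigO.norm_left.pow k)

namespace IsNormalizingMap

variable {Φ : CanonicalSpace → CanonicalSpace}

theorem tendsto_q_axis (hΦ : IsNormalizingMap Φ) :
    Filter.Tendsto (fun x : ℝ => Φ ![x, 0, 0, 0]) (𝓝 0) (𝓝[{u | hilbertS u = 0}] 0) := by
  refine tendsto_nhdsWithin_iff.2 ⟨?_, .of_forall fun x => ?_⟩
  · have axis_zero : (![0, 0, 0, 0] : CanonicalSpace) = 0 := by simp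
    exact (hΦ.contDiff.continuous.comp (by fun_prop)).tendsto' _ _
      ((congrArg Φ axis_zero).trans hΦ.map_zero)
  · exact (congrFun hΦ.hilbertS_comp _).trans (by simp [hilbertS])

theorem sq_isBigO_hilbertM_q_axis (hΦ : IsNormalizingMap Φ) :
    (fun x : ℝ => x ^ 2) =O[𝓝 0] fun x => hilbertM (Φ ![x, 0, 0, 0]) := by
  have hM : hilbertM ∘ Φ - hilbertM ∈ vanishing 4 := invariantsFrom_le_vanishing 2
    (hΦ.comp_sub_mem (pow_le_invariantsFrom le_rfl
      ((pow_one invariantForms).symm ▸ hilbertM_mem)))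
  have difference : (fun x : ℝ => hilbertM (Φ ![x, 0, 0, 0]) - x ^ 2 / 2) =O[𝓝 0]
      fun x => x ^ 4 := by
    simpa [hilbertM] using comp_q_axis_isBigO hM
  have half : (fun x : ℝ => x ^ 2) =O[𝓝 0] fun x => x ^ 2 / 2 :=
    IsBigO.of_bound 2 (.of_forall fun x => by simp [mul_div_cancel₀])
  have small := (difference.trans_isLittleO
    (isLittleO_pow_pow (by norm_num : 2 < 4))).trans_isBigO half
  simpa only [sub_add_cancel] using! half.trans small.right_isBigO_add

theorem exists_apply_q_axis_ne_zero (hΦ : IsNormalizingMap Φ) {F G : CanonicalSpace → ℝ}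
    (hF : (hilbertM ^ 3) =O[𝓝[{u | hilbertS u = 0}] 0] F) (hG : F ∘ Φ - G ∈ vanishing 7) :
    ∃ x : ℝ, G ![x, 0, 0, 0] ≠ 0 := by
  by_contra! hG_axis
  have upper : (fun x : ℝ => F (Φ ![x, 0, 0, 0])) =O[𝓝 0] fun x => x ^ 7 := by
    simpa only [Pi.sub_apply, hG_axis, sub_zero] using! comp_q_axis_isBigO hG
  have sixth_isBigO_seventh : (fun x : ℝ => x ^ 6) =O[𝓝 0] fun x => x ^ 7 := by
    have h := (hΦ.sq_isBigO_hilbertM_q_axis.pow 3).trans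
      ((hF.comp_tendsto hΦ.tendsto_q_axis).trans upper)
    simpa only [← pow_mul] using h
  have frequently_ne_zero : ∃ᶠ x : ℝ in 𝓝 0, x ^ 7 ≠ 0 :=
    (eventually_mem_nhdsWithin.frequently.filter_mono nhdsWithin_le_nhds :
      ∃ᶠ x : ℝ in 𝓝 0, x ∈ ({0}ᶜ : Set ℝ)).mono fun x hx => pow_ne_zero 7 hx
  exact (isLittleO_pow_pow (by norm_num : 6 < 7)).not_isBigO frequently_ne_zero
    sixth_isBigO_seventh

end IsNormalizingMap

theorem exists_degenerate_normalForm {ρ n : ℝ} (hn : n ≠ 0) {F f₂ f₃ : CanonicalSpace → ℝ}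
    (hf₂ : f₂ ∈ invariantForms ^ 2) (hf₂_axis : f₂ ![1, 0, 0, 0] = 0) (hf₃ : f₃ ∈ invariantsFrom 3)
    (hF : F - (ρ • hilbertS + n • hilbertN + f₂ + f₃) ∈ vanishing 7)
    (hF_lower : (hilbertM ^ 3) =O[𝓝[{u | hilbertS u = 0}] 0] F) :
    ∃ Φ, IsNormalizingMap Φ ∧ ∃ a₄ a₅ a₆ a₇ a₈ a₉ : ℝ, a₆ ≠ 0 ∧
      F ∘ Φ - (ρ • hilbertS + n • hilbertN + (a₄ • (hilbertM * hilbertS) + a₅ • hilbertS ^ 2)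
        + (a₆ • hilbertM ^ 3 + a₇ • (hilbertM ^ 2 * hilbertS) + a₈ • (hilbertM * hilbertS ^ 2)
          + a₉ • hilbertS ^ 3)) ∈ vanishing 7 := by
  obtain ⟨Φ, hΦ, ν₂, hν₂, ν₃, hν₃, hν₂_axis, h⟩ := exists_normalForm ρ hn hf₂ hf₃ hF
  obtain ⟨a₄, a₅, rfl⟩ := exists_eq_of_mem_normalForms_two hν₂ (hν₂_axis.trans hf₂_axis)
  obtain ⟨a₆, a₇, a₈, a₉, rfl⟩ := exists_eq_of_mem_normalForms_three hν₃
  rw [add_sub_cancel] at h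
  refine ⟨Φ, hΦ, a₄, a₅, a₆, a₇, a₈, a₉, ?_, h⟩
  rintro rfl
  obtain ⟨x, hx⟩ := hΦ.exists_apply_q_axis_ne_zero hF_lower h
  exact hx (by simp [hilbertS, hilbertN])

/-! ### A criterion for degenerate Hamiltonian Hopf bifurcations -/

/-- The linear map `(q, p) ↦ (c q, c⁻¹ p)`. -/
noncomputable def scaling (c : ℝ) : CanonicalSpace →L[ℝ] CanonicalSpace :=
  LinearMap.toContinuousLinearMap
    { toFun := fun u => ![c * u 0, c * u 1, c⁻¹ * u 2, c⁻¹ * u 3]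
      map_add' := fun u v => by
        ext i; fin_cases i <;> simp <;> ring
      map_smul' := fun c u => by
        ext i; fin_cases i <;> simp <;> ring }

theorem scaling_apply (c : ℝ) (u : CanonicalSpace) :
    scaling c u = ![c * u 0, c * u 1, c⁻¹ * u 2, c⁻¹ * u 3] := rfl

theorem scaling_inv_scaling {c : ℝ} (hc : c ≠ 0) (u : CanonicalSpace) :
    scaling c⁻¹ (scaling c u) = u := by
  ext i; fin_cases i <;> simp [scaling_apply, hc]

theorem isSymplecticMap_scaling {c : ℝ} (hc : c ≠ 0) : IsSymplecticMap (scaling c) :=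
  .of_linear (Function.LeftInverse.injective (scaling_inv_scaling hc))
    fun a b => by simp only [standardForm, scaling_apply, Matrix.cons_val]; field_simp

theorem hilbertS_comp_scaling {c : ℝ} (hc : c ≠ 0) : hilbertS ∘ scaling c = hilbertS := by
  funext u
  simp only [Function.comp_apply, hilbertS, scaling_apply, Matrix.cons_val]
  field_simp

theorem hilbertM_comp_scaling (c : ℝ) : hilbertM ∘ scaling c = c ^ 2 • hilbertM := by
  funext u
  simp only [Function.comp_apply, hilbertM, scaling_apply, Matrix.cons_val, Pi.smul_apply,
    smul_eq_mul]
  ring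

theorem hilbertN_comp_scaling (c : ℝ) : hilbertN ∘ scaling c = (c ^ 2)⁻¹ • hilbertN := by
  funext u
  simp only [Function.comp_apply, hilbertN, scaling_apply, Matrix.cons_val, Pi.smul_apply,
    smul_eq_mul]
  ring

theorem contDiffOn_scaling {c : ℝ → ℝ} {W : Set ℝ} (hc : ContDiffOn ℝ ∞ c W)
    (hc0 : ∀ t ∈ W, c t ≠ 0) :
    ContDiffOn ℝ ∞ (fun x : ℝ × CanonicalSpace => scaling (c x.1) x.2) (W ×ˢ univ) := by
  have hc' : ContDiffOn ℝ ∞ (fun x : ℝ × CanonicalSpace => c x.1) (W ×ˢ univ) :=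
    hc.comp contDiffOn_fst fun x hx => hx.1
  have hc_inv := hc'.inv fun x hx => hc0 x.1 hx.1
  have coord (i : Fin 4) : ContDiffOn ℝ ∞ (fun x : ℝ × CanonicalSpace => x.2 i) (W ×ˢ univ) := by
    fun_prop
  rw [contDiffOn_pi]
  intro i
  fin_cases i
  · exact hc'.mul (coord 0)
  · exact hc'.mul (coord 1)
  · exact hc_inv.mul (coord 2)
  · exact hc_inv.mul (coord 3)

theorem IsCanonicalCoordinates.comp {R₁ R₂ : ℝ} {z₀ : GaudinAmbient} {V U : Set CanonicalSpace}
    {ψ : CanonicalSpace → GaudinAmbient} {Φ : CanonicalSpace → CanonicalSpace}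
    (h : IsCanonicalCoordinates R₁ R₂ z₀ V ψ) (hΦ : IsSymplecticMap Φ) (hU : IsOpen U)
    (hU_zero : 0 ∈ U) (hUV : MapsTo Φ U V) : IsCanonicalCoordinates R₁ R₂ z₀ U (ψ ∘ Φ) where
  isOpen := hU
  zero_mem := hU_zero
  map_zero := by rw [Function.comp_apply, hΦ.map_zero, h.map_zero]
  contDiffOn := h.contDiffOn.comp hΦ.contDiff.contDiffOn hUV
  injOn := h.injOn.comp hΦ.injective.injOn hUV
  mapsTo := h.mapsTo.comp hUV
  symplectic u hu a b := by
    have hψ : DifferentiableAt ℝ ψ (Φ u) :=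
      (h.contDiffOn.contDiffAt (h.isOpen.mem_nhds (hUV hu))).differentiableAt (by simp)
    rw [fderiv_comp u hψ (hΦ.differentiable u), ContinuousLinearMap.comp_apply,
      ContinuousLinearMap.comp_apply, Function.comp_apply, h.symplectic _ (hUV hu),
      hΦ.symplectic]

/-- The function `h`, read in the coordinates `ψ` around `z₀` and normalised by an additive constant
to vanish at the origin. -/
def localExpression (h : GaudinAmbient → ℝ) (z₀ : GaudinAmbient)
    (ψ : CanonicalSpace → GaudinAmbient) : CanonicalSpace → ℝ := fun u => h (ψ u) - h z₀

theorem hasFDerivAt_zero_of_localExpression_mem {h : GaudinAmbient → ℝ} {z₀ : GaudinAmbient}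
    {ψ : CanonicalSpace → GaudinAmbient} (hh : localExpression h z₀ ψ ∈ vanishing 2) :
    HasFDerivAt (fun u => h (ψ u)) (0 : CanonicalSpace →L[ℝ] ℝ) 0 := by
  have flat : localExpression h z₀ ψ =O[𝓝 0] fun u => ‖u - 0‖ ^ 2 := by
    simp only [sub_zero]
    exact hh
  exact (hasFDerivAt_sub_const_iff (h z₀)).1 (flat.hasFDerivAt one_lt_two)

theorem exists_uniform_coordinate_domain {Θ : ℝ → CanonicalSpace → CanonicalSpace} {τ : ℝ}
    {W : Set ℝ} {V : Set CanonicalSpace} (hW : IsOpen W) (hτ : τ ∈ W) (hV : V ∈ 𝓝 (Θ τ 0))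
    (hΘ : ContinuousOn (fun x : ℝ × CanonicalSpace => Θ x.1 x.2) (W ×ˢ univ)) :
    ∃ ε > 0, Ioo (τ - ε) (τ + ε) ⊆ W ∧
      ∀ t ∈ Ioo (τ - ε) (τ + ε), MapsTo (Θ t) (Metric.ball 0 ε) V := by
  have domain_nhds : W ×ˢ (univ : Set CanonicalSpace) ∈ 𝓝 (τ, 0) :=
    (hW.prod isOpen_univ).mem_nhds ⟨hτ, mem_univ _⟩
  obtain ⟨ε, hε, h⟩ := Metric.eventually_nhds_iff_ball.1
    (Filter.Eventually.and domain_nhds ((hΘ.continuousAt domain_nhds).eventually hV))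
  simp only [← ball_prod_same, Real.ball_eq_Ioo] at h
  exact ⟨ε, hε, fun t ht => (h (t, 0) ⟨ht, Metric.mem_ball_self hε⟩).1.1,
    fun t ht u hu => (h (t, u) ⟨ht, hu⟩).2⟩

theorem mul_inv_sq_sqrt {σ k : ℝ} (hσ : σ = 1 ∨ σ = -1) (h : 0 < σ * k) :
    k * (√(σ * k) ^ 2)⁻¹ = σ := by
  have hk : k ≠ 0 := right_ne_zero_of_mul h.ne'
  rw [Real.sq_sqrt h.le]
  rcases hσ with rfl | rfl <;> field_simp

section Criterion

variable {R₁ R₂ τ : ℝ} {J : GaudinAmbient → ℝ} {H : ℝ → GaudinAmbient → ℝ} {z₀ : GaudinAmbient}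
  {V : Set CanonicalSpace} {ψ : CanonicalSpace → GaudinAmbient} {r k l : ℝ → ℝ}

theorem IsNormalizingMap.second_order_comp_scaling {Φ : CanonicalSpace → CanonicalSpace}
    (hΦ : IsNormalizingMap Φ) {F : CanonicalSpace → ℝ} {ρ σ n m : ℝ} (hσ : σ = 1 ∨ σ = -1)
    (hσn : 0 < σ * n) (hF : F - (ρ • hilbertS + n • hilbertN + m • hilbertM) ∈ vanishing 4) :
    F ∘ Φ ∘ scaling √(σ * n)
      - (ρ • hilbertS + σ • hilbertN + (σ * n * m) • hilbertM) ∈ vanishing 4 := by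
  have hc : √(σ * n) ≠ 0 := (Real.sqrt_pos.2 hσn).ne'
  have quadratic_mem : ρ • hilbertS + n • hilbertN + m • hilbertM ∈ invariantForms ^ 1 := by
    rw [pow_one]
    exact add_mem (add_mem (Submodule.smul_mem _ _ hilbertS_mem)
      (Submodule.smul_mem _ _ hilbertN_mem)) (Submodule.smul_mem _ _ hilbertM_mem)
  have normalized := add_mem (hΦ.comp_mem_vanishing hF) (invariantsFrom_le_vanishing 2
    (hΦ.comp_sub_mem (pow_le_invariantsFrom le_rfl quadratic_mem)))
  convert (isSymplecticMap_scaling hc).comp_mem_vanishing normalized using 1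
  simp only [Pi.sub_comp, Pi.add_comp, Pi.smul_comp, hilbertS_comp_scaling hc,
    hilbertN_comp_scaling, hilbertM_comp_scaling, smul_smul, Function.comp_assoc,
    sub_add_sub_cancel]
  rw [mul_inv_sq_sqrt hσ hσn, Real.sq_sqrt hσn.le, mul_comm m]

theorem fderiv_prodMk_eq_zero {h : GaudinAmbient → ℝ} {ρ n m : ℝ}
    (hJ : localExpression J z₀ ψ ∈ vanishing 2)
    (hh : localExpression h z₀ ψ - (ρ • hilbertS + n • hilbertN + m • hilbertM) ∈ vanishing 2) :
    fderiv ℝ (fun u => (J (ψ u), h (ψ u))) 0 = 0 := by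
  have quadratic_mem : ρ • hilbertS + n • hilbertN + m • hilbertM ∈ vanishing 2 :=
    invariantForms_le_vanishing (add_mem (add_mem (Submodule.smul_mem _ _ hilbertS_mem)
      (Submodule.smul_mem _ _ hilbertN_mem)) (Submodule.smul_mem _ _ hilbertM_mem))
  have hh' := add_mem hh quadratic_mem
  rw [sub_add_cancel] at hh'
  exact ((hasFDerivAt_zero_of_localExpression_mem hJ).prodMk
    (hasFDerivAt_zero_of_localExpression_mem hh')).fderiv

theorem deriv_neg_mul_ne_zero {σ : ℝ} (hk : DifferentiableAt ℝ k τ) (hl : DifferentiableAt ℝ l τ)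
    (hσk : σ * k τ ≠ 0) (hl_zero : l τ = 0) (hl_deriv : deriv l τ ≠ 0) :
    deriv (fun t => -(σ * k t * l t)) τ ≠ 0 := by
  have h := ((hk.hasDerivAt.const_mul σ).mul hl.hasDerivAt).neg.deriv
  rw [hl_zero, mul_zero, zero_add] at h
  exact h ▸ neg_ne_zero.2 (mul_ne_zero hσk hl_deriv)

theorem exists_isLinearHopfUnfolding {Φ : CanonicalSpace → CanonicalSpace} {σ : ℝ}
    (hψ : IsCanonicalCoordinates R₁ R₂ z₀ V ψ) (hΦ : IsNormalizingMap Φ)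
    (hJ : localExpression J z₀ ψ ∈ vanishing 2)
    (hH : ∀ t, localExpression (H t) z₀ ψ
      - (r t • hilbertS + k t • hilbertN + l t • hilbertM) ∈ vanishing 4)
    (hr : ContDiff ℝ ∞ r) (hk : ContDiff ℝ ∞ k) (hl : ContDiff ℝ ∞ l)
    (hr_ne : r τ ≠ 0) (hl_zero : l τ = 0) (hl_deriv : deriv l τ ≠ 0)
    (hσ : σ = 1 ∨ σ = -1) (hσk : 0 < σ * k τ) :
    ∃ ε U, IsLinearHopfUnfolding R₁ R₂ J H z₀ τ (r τ) σ ε (fun t => r t - r τ)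
      (fun t => -(σ * k t * l t)) U fun t => ψ ∘ Φ ∘ scaling √(σ * k t) := by
  have scaling_smooth : ContDiffOn ℝ ∞
      (fun x : ℝ × CanonicalSpace => Φ (scaling √(σ * k x.1) x.2)) ({t | 0 < σ * k t} ×ˢ univ) :=
    hΦ.contDiff.comp_contDiffOn (contDiffOn_scaling
      (ContDiffOn.sqrt (by fun_prop) fun t ht => ne_of_gt ht) fun t ht => (Real.sqrt_pos.2 ht).ne')
  have base_point (c : ℝ) : Φ (scaling c 0) = 0 := by rw [map_zero, hΦ.map_zero]
  obtain ⟨ε, hε, hW, hV⟩ := exists_uniform_coordinate_domain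
    (Θ := fun t u => Φ (scaling √(σ * k t) u)) (V := V)
    (isOpen_lt continuous_const (continuous_const.mul hk.continuous)) hσk
    (by rw [base_point]; exact hψ.isOpen.mem_nhds hψ.zero_mem) scaling_smooth.continuousOn
  have symplectic (t : ℝ) (ht : t ∈ Ioo (τ - ε) (τ + ε)) :
      IsSymplecticMap (Φ ∘ scaling √(σ * k t)) :=
    hΦ.toIsSymplecticMap.comp (isSymplecticMap_scaling (Real.sqrt_pos.2 (hW ht)).ne')
  have second_order (t : ℝ) (ht : t ∈ Ioo (τ - ε) (τ + ε)) :
      localExpression (H t) z₀ (ψ ∘ Φ ∘ scaling √(σ * k t)) - (r t • hilbertS + σ • hilbertN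
        + (σ * k t * l t) • hilbertM) ∈ vanishing 4 :=
    hΦ.second_order_comp_scaling hσ (hW ht) (hH t)
  refine ⟨ε, Metric.ball 0 ε, ?_⟩
  exact
    { rho_ne_zero := hr_ne
      sigma_eq := hσ
      eps_pos := hε
      nu₁_smooth := (hr.sub contDiff_const).contDiffOn
      nu₂_smooth := ((contDiff_const.mul hk).mul hl).neg.contDiffOn
      nu₁_zero := sub_self _
      nu₂_zero := by rw [hl_zero, mul_zero, neg_zero]
      transversal := deriv_neg_mul_ne_zero (hk.differentiable (by simp) τ)
        (hl.differentiable (by simp) τ) hσk.ne' hl_zero hl_deriv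
      coordinates_smooth := hψ.contDiffOn.comp
        (scaling_smooth.mono (prod_mono hW (subset_univ _))) fun x hx => hV x.1 hx.1 hx.2
      coordinates t ht := hψ.comp (symplectic t ht) Metric.isOpen_ball
        (Metric.mem_ball_self hε) (hV t ht)
      rank_zero t ht := fderiv_prodMk_eq_zero ((symplectic t ht).comp_mem_vanishing hJ)
        (vanishing_antitone (by lia) (second_order t ht))
      second_order t ht := by
        have h : _ =O[𝓝 0] fun u : CanonicalSpace => ‖u‖ ^ 3 :=
          vanishing_antitone (by lia : 3 ≤ 4) (second_order t ht)
        refine h.congr_left fun u => ?_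
        simp only [localExpression, Function.comp_apply, Pi.sub_apply, Pi.add_apply,
          Pi.smul_apply, smul_eq_mul]
        ring }

theorem degenerateHamiltonianHopf_of_expansion {f₂ f₃ : CanonicalSpace → ℝ}
    (hψ : IsCanonicalCoordinates R₁ R₂ z₀ V ψ) (hJ : localExpression J z₀ ψ ∈ vanishing 2)
    (hH : ∀ t, localExpression (H t) z₀ ψ
      - (r t • hilbertS + k t • hilbertN + l t • hilbertM) ∈ vanishing 4)
    (hr : ContDiff ℝ ∞ r) (hk : ContDiff ℝ ∞ k) (hl : ContDiff ℝ ∞ l)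
    (hr_ne : r τ ≠ 0) (hk_ne : k τ ≠ 0) (hl_zero : l τ = 0) (hl_deriv : deriv l τ ≠ 0)
    (hf₂ : f₂ ∈ invariantForms ^ 2) (hf₂_axis : f₂ ![1, 0, 0, 0] = 0) (hf₃ : f₃ ∈ invariantsFrom 3)
    (hHτ : localExpression (H τ) z₀ ψ - (r τ • hilbertS + k τ • hilbertN + f₂ + f₃) ∈ vanishing 7)
    (hHτ_lower : (hilbertM ^ 3) =O[𝓝[{u | hilbertS u = 0}] 0] localExpression (H τ) z₀ ψ) :
    DegenerateHamiltonianHopf R₁ R₂ J H z₀ τ := by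
  obtain ⟨Φ, hΦ, a₄, a₅, a₆, a₇, a₈, a₉, ha₆, normal_form⟩ :=
    exists_degenerate_normalForm hk_ne hf₂ hf₂_axis hf₃ hHτ hHτ_lower
  obtain ⟨σ, hσ, hσk⟩ : ∃ σ : ℝ, (σ = 1 ∨ σ = -1) ∧ 0 < σ * k τ := by
    rcases hk_ne.lt_or_gt with h | h
    · exact ⟨-1, .inr rfl, by linarith⟩
    · exact ⟨1, .inl rfl, by linarith⟩
  obtain ⟨ε, U, unfolding⟩ :=
    exists_isLinearHopfUnfolding hψ hΦ hJ hH hr hk hl hr_ne hl_zero hl_deriv hσ hσk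
  set c := √(σ * k τ)
  have hc : c ≠ 0 := (Real.sqrt_pos.2 hσk).ne'
  refine ⟨r τ, σ, ε, _, _, U, _, 0, a₄ * c ^ 2, a₅, a₆ * c ^ 6, a₇ * c ^ 4, a₈ * c ^ 2, a₉,
    unfolding, ?_, rfl, mul_ne_zero ha₆ (pow_ne_zero 6 hc)⟩
  have h : _ =O[𝓝 0] fun u : CanonicalSpace => ‖u‖ ^ 7 :=
    (isSymplecticMap_scaling hc).comp_mem_vanishing normal_form
  refine h.congr_left fun u => ?_
  have hS : hilbertS (scaling c u) = hilbertS u := congrFun (hilbertS_comp_scaling hc) u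
  have hM : hilbertM (scaling c u) = c ^ 2 * hilbertM u := congrFun (hilbertM_comp_scaling c) u
  have hN : hilbertN (scaling c u) = (c ^ 2)⁻¹ * hilbertN u := congrFun (hilbertN_comp_scaling c) u
  simp only [localExpression, Function.comp_apply, Pi.sub_apply, Pi.add_apply, Pi.smul_apply,
    Pi.mul_apply, Pi.pow_apply, smul_eq_mul, hS, hM, hN]
  linear_combination (-hilbertN u) * mul_inv_sq_sqrt hσ hσk

end Criterion

/-! ### Canonical coordinates for the Gaudin model -/

theorem hasFDerivAt_vec_three {E : Type*} [NormedAddCommGroup E] [NormedSpace ℝ E]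
    {f₀ f₁ f₂ : E → ℝ} {D₀ D₁ D₂ : E →L[ℝ] ℝ} {u : E} (h₀ : HasFDerivAt f₀ D₀ u)
    (h₁ : HasFDerivAt f₁ D₁ u) (h₂ : HasFDerivAt f₂ D₂ u) :
    HasFDerivAt (fun v => ![f₀ v, f₁ v, f₂ v]) (ContinuousLinearMap.pi ![D₀, D₁, D₂]) u := by
  refine hasFDerivAt_pi.2 fun i => ?_
  fin_cases i <;> simpa

/-- The haversine `sin² (θ / 2) = (1 - z) / 2` of the polar angle `θ` of the point with coordinates
`v` in `sphereChart`. -/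
noncomputable def haversine (R : ℝ) (v : ℝ × ℝ) : ℝ := (v.1 ^ 2 + v.2 ^ 2) / (8 * R)

/-- The ratio by which `sphereChart` contracts the horizontal plane. -/
noncomputable def sphereFactor (R : ℝ) (v : ℝ × ℝ) : ℝ := √((1 - haversine R v) / (2 * R))

/-- The chart of the sphere around the north pole given by Lambert's area-preserving projection,
scaled to pull `R ω_{S²}` back to `(dx ∧ dy) / 2`. -/
noncomputable def sphereChart (R : ℝ) (v : ℝ × ℝ) : Fin 3 → ℝ :=
  ![v.1 * sphereFactor R v, v.2 * sphereFactor R v, 1 - 2 * haversine R v]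

section SphereChart

variable {R : ℝ} {v : ℝ × ℝ}

theorem sphereFactor_arg_pos (hR : 0 < R) (hv : haversine R v < 1) :
    0 < (1 - haversine R v) / (2 * R) :=
  div_pos (sub_pos.2 hv) (by positivity)

theorem sphereFactor_pos (hR : 0 < R) (hv : haversine R v < 1) : 0 < sphereFactor R v :=
  Real.sqrt_pos.2 (sphereFactor_arg_pos hR hv)

theorem sphereFactor_sq (hR : 0 < R) (hv : haversine R v < 1) :
    sphereFactor R v ^ 2 = (1 - haversine R v) / (2 * R) :=
  Real.sq_sqrt (sphereFactor_arg_pos hR hv).le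

theorem sphereChart_mem_sphere (hR : 0 < R) (hv : haversine R v < 1) :
    sphereChart R v 0 ^ 2 + sphereChart R v 1 ^ 2 + sphereChart R v 2 ^ 2 = 1 := by
  have hw := sphereFactor_sq hR hv
  simp only [sphereChart, Matrix.cons_val]
  rw [mul_pow, mul_pow, hw, haversine]
  field_simp
  ring

theorem injOn_sphereChart (hR : 0 < R) : InjOn (sphereChart R) {v | haversine R v < 1} := by
  intro v hv v' _ h
  have h_fst := congrFun h 0
  have h_snd := congrFun h 1
  have h_height := congrFun h 2
  simp only [sphereChart, Matrix.cons_val] at h_fst h_snd h_height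
  have same_factor : sphereFactor R v = sphereFactor R v' := by
    rw [sphereFactor, sphereFactor, show haversine R v = haversine R v' by linarith]
  rw [← same_factor] at h_fst h_snd
  have hw := (sphereFactor_pos hR hv).ne'
  exact Prod.ext (mul_right_cancel₀ hw h_fst) (mul_right_cancel₀ hw h_snd)

theorem contDiff_haversine (R : ℝ) : ContDiff ℝ ∞ (haversine R) := by
  unfold haversine
  fun_prop

theorem isOpen_haversine_lt_one (R : ℝ) : IsOpen {v | haversine R v < 1} :=
  isOpen_lt (contDiff_haversine R).continuous continuous_const

theorem contDiffOn_sphereChart (hR : 0 < R) :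
    ContDiffOn ℝ ∞ (sphereChart R) {v | haversine R v < 1} := by
  have smooth_haversine := contDiff_haversine R
  have smooth_factor : ContDiffOn ℝ ∞ (sphereFactor R) {v | haversine R v < 1} :=
    ContDiffOn.sqrt (by fun_prop) fun v hv => (sphereFactor_arg_pos hR hv).ne'
  refine contDiffOn_pi.2 fun i => ?_
  fin_cases i
  · exact contDiff_fst.contDiffOn.mul smooth_factor
  · exact contDiff_snd.contDiffOn.mul smooth_factor
  · exact (contDiff_const.sub (contDiff_const.mul smooth_haversine)).contDiffOn

theorem differentiableAt_sphereChart (hR : 0 < R) (hv : haversine R v < 1) :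
    DifferentiableAt ℝ (sphereChart R) v :=
  ((contDiffOn_sphereChart hR).contDiffAt
    ((isOpen_haversine_lt_one R).mem_nhds hv)).differentiableAt (by simp)

theorem hasFDerivAt_sphereFactor (hR : 0 < R) (hv : haversine R v < 1) :
    HasFDerivAt (sphereFactor R) ((-(16 * R ^ 2 * sphereFactor R v)⁻¹) •
      (v.1 • ContinuousLinearMap.fst ℝ ℝ ℝ + v.2 • ContinuousLinearMap.snd ℝ ℝ ℝ)) v := by
  refine HasFDerivAt.congr_fderiv ((((hasFDerivAt_fst.pow 2).add (hasFDerivAt_snd.pow 2)).mul_const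
    (8 * R)⁻¹ |>.const_sub 1).mul_const (2 * R)⁻¹ |>.sqrt (sphereFactor_arg_pos hR hv).ne') ?_
  change (1 / (2 * sphereFactor R v)) • _ = _
  ext <;> simp <;> ring

theorem fderiv_sphereChart_apply (hR : 0 < R) (hv : haversine R v < 1) (a : ℝ × ℝ) :
    fderiv ℝ (sphereChart R) v a =
      ![sphereFactor R v * a.1
          - v.1 * (v.1 * a.1 + v.2 * a.2) / (16 * R ^ 2 * sphereFactor R v),
        sphereFactor R v * a.2
          - v.2 * (v.1 * a.1 + v.2 * a.2) / (16 * R ^ 2 * sphereFactor R v),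
        -(v.1 * a.1 + v.2 * a.2) / (2 * R)] := by
  have hw := hasFDerivAt_sphereFactor hR hv
  have hD : HasFDerivAt (sphereChart R) _ v :=
    hasFDerivAt_vec_three (hasFDerivAt_fst.mul hw) (hasFDerivAt_snd.mul hw)
      (((hasFDerivAt_fst.pow 2).add (hasFDerivAt_snd.pow 2)).mul_const (8 * R)⁻¹
        |>.const_mul 2 |>.const_sub 1)
  rw [hD.fderiv]
  ext i
  fin_cases i <;> simp <;> ring

theorem sphereForm_fderiv_sphereChart (hR : 0 < R) (hv : haversine R v < 1) (a b : ℝ × ℝ) :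
    R * (sphereChart R v ⬝ᵥ (fderiv ℝ (sphereChart R) v a ⨯₃ fderiv ℝ (sphereChart R) v b))
      = (a.1 * b.2 - b.1 * a.2) / 2 := by
  have hw := (sphereFactor_pos hR hv).ne'
  have hw_sq := sphereFactor_sq hR hv
  rw [haversine] at hw_sq
  simp only [fderiv_sphereChart_apply hR hv, sphereChart, haversine, cross_apply,
    Matrix.vec3_dotProduct, Matrix.cons_val]
  generalize sphereFactor R v = w at hw hw_sq ⊢
  field_simp at hw_sq ⊢
  linear_combination 64 * R ^ 2 * w ^ 2 * (4 * R + (v.1 ^ 2 + v.2 ^ 2)) *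
    (a.1 * b.2 - b.1 * a.2) * hw_sq

end SphereChart

/-- The half-turn `(x, y, z) ↦ (x, -y, -z)`, which exchanges the poles of the sphere. -/
def halfTurn : (Fin 3 → ℝ) →L[ℝ] (Fin 3 → ℝ) :=
  ContinuousLinearMap.pi ![.proj 0, -.proj 1, -.proj 2]

theorem halfTurn_apply (v : Fin 3 → ℝ) : halfTurn v = ![v 0, -v 1, -v 2] := by
  ext i
  fin_cases i <;> rfl

theorem halfTurn_injective : Function.Injective halfTurn :=
  Function.LeftInverse.injective (g := halfTurn) fun v => by
    ext i
    fin_cases i <;> simp [halfTurn_apply]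

theorem halfTurn_dotProduct_cross (v a b : Fin 3 → ℝ) :
    halfTurn v ⬝ᵥ (halfTurn a ⨯₃ halfTurn b) = v ⬝ᵥ (a ⨯₃ b) := by
  simp only [halfTurn_apply, cross_apply, Matrix.vec3_dotProduct, Matrix.cons_val]
  ring

/-- The coordinates of `sphereChart` for the first sphere in terms of canonical coordinates;
together with `southCoordinates` they satisfy
`(dx₁ ∧ dy₁ + dx₂ ∧ dy₂) / 2 = dq₁ ∧ dp₁ + dq₂ ∧ dp₂`. -/
def northCoordinates : CanonicalSpace →L[ℝ] ℝ × ℝ :=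
  .prod (.proj 0 - .proj 3) (.proj 1 + .proj 2)

/-- The coordinates of `sphereChart` for the second sphere in terms of canonical coordinates. -/
def southCoordinates : CanonicalSpace →L[ℝ] ℝ × ℝ :=
  .prod (-(.proj 0 + .proj 3)) (.proj 1 - .proj 2)

theorem northCoordinates_apply (u : CanonicalSpace) :
    northCoordinates u = (u 0 - u 3, u 1 + u 2) := rfl

theorem southCoordinates_apply (u : CanonicalSpace) :
    southCoordinates u = (-(u 0 + u 3), u 1 - u 2) := rfl

/-- Canonical coordinates on `S² × S²` around `m₀`, in which `J - J(m₀) = S`. -/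
noncomputable def gaudinChart (R₁ R₂ : ℝ) (u : CanonicalSpace) : GaudinAmbient :=
  (sphereChart R₁ (northCoordinates u), halfTurn (sphereChart R₂ (southCoordinates u)))

/-- The domain of the canonical coordinates `gaudinChart`. -/
def gaudinChartDomain (R₁ R₂ : ℝ) : Set CanonicalSpace :=
  {u | haversine R₁ (northCoordinates u) < 1 ∧ haversine R₂ (southCoordinates u) < 1}

section GaudinChart

variable {R₁ R₂ : ℝ}

theorem isOpen_gaudinChartDomain : IsOpen (gaudinChartDomain R₁ R₂) :=
  ((isOpen_haversine_lt_one R₁).preimage northCoordinates.continuous).inter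
    ((isOpen_haversine_lt_one R₂).preimage southCoordinates.continuous)

theorem zero_mem_gaudinChartDomain : 0 ∈ gaudinChartDomain R₁ R₂ := by
  simp [gaudinChartDomain, haversine]

theorem contDiffOn_gaudinChart (hR₁ : 0 < R₁) (hR₂ : 0 < R₂) :
    ContDiffOn ℝ ∞ (gaudinChart R₁ R₂) (gaudinChartDomain R₁ R₂) :=
  ((contDiffOn_sphereChart hR₁).comp northCoordinates.contDiff.contDiffOn fun _ hu => hu.1).prodMk
    (halfTurn.contDiff.comp_contDiffOn ((contDiffOn_sphereChart hR₂).comp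
      southCoordinates.contDiff.contDiffOn fun _ hu => hu.2))

theorem injOn_gaudinChart (hR₁ : 0 < R₁) (hR₂ : 0 < R₂) :
    InjOn (gaudinChart R₁ R₂) (gaudinChartDomain R₁ R₂) := by
  intro u hu v hv h
  obtain ⟨h_north, h_south⟩ := Prod.ext_iff.1 h
  have same_north := injOn_sphereChart hR₁ hu.1 hv.1 h_north
  have same_south := injOn_sphereChart hR₂ hu.2 hv.2 (halfTurn_injective h_south)
  simp only [northCoordinates_apply, southCoordinates_apply, Prod.mk.injEq]
    at same_north same_south
  ext i
  fin_cases i <;> simp only [Fin.zero_eta, Fin.mk_one, Fin.reduceFinMk] <;>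
    linarith [same_north.1, same_north.2, same_south.1, same_south.2]

theorem mapsTo_gaudinChart (hR₁ : 0 < R₁) (hR₂ : 0 < R₂) :
    MapsTo (gaudinChart R₁ R₂) (gaudinChartDomain R₁ R₂) gaudinPhaseSpace := by
  refine fun u hu => ⟨sphereChart_mem_sphere hR₁ hu.1, ?_⟩
  simpa only [gaudinChart, halfTurn_apply, Matrix.cons_val, neg_sq] using
    sphereChart_mem_sphere hR₂ hu.2

theorem fderiv_gaudinChart_apply (hR₁ : 0 < R₁) (hR₂ : 0 < R₂) {u : CanonicalSpace}
    (hu : u ∈ gaudinChartDomain R₁ R₂) (a : CanonicalSpace) :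
    fderiv ℝ (gaudinChart R₁ R₂) u a =
      (fderiv ℝ (sphereChart R₁) (northCoordinates u) (northCoordinates a),
        halfTurn (fderiv ℝ (sphereChart R₂) (southCoordinates u) (southCoordinates a))) := by
  have north := (differentiableAt_sphereChart hR₁ hu.1).hasFDerivAt.comp u
    northCoordinates.hasFDerivAt
  have south := (differentiableAt_sphereChart hR₂ hu.2).hasFDerivAt.comp u
    southCoordinates.hasFDerivAt
  exact DFunLike.congr_fun (north.prodMk (halfTurn.hasFDerivAt.comp u south)).fderiv a

theorem isCanonicalCoordinates_gaudinChart (hR₁ : 0 < R₁) (hR₂ : 0 < R₂) :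
    IsCanonicalCoordinates R₁ R₂ gaudinM0 (gaudinChartDomain R₁ R₂) (gaudinChart R₁ R₂) where
  isOpen := isOpen_gaudinChartDomain
  zero_mem := zero_mem_gaudinChartDomain
  map_zero := by simp [gaudinChart, sphereChart, gaudinM0, haversine, halfTurn_apply]
  contDiffOn := contDiffOn_gaudinChart hR₁ hR₂
  injOn := injOn_gaudinChart hR₁ hR₂
  mapsTo := mapsTo_gaudinChart hR₁ hR₂
  symplectic u hu a b := by
    rw [fderiv_gaudinChart_apply hR₁ hR₂ hu, fderiv_gaudinChart_apply hR₁ hR₂ hu, gaudinForm,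
      gaudinChart, halfTurn_dotProduct_cross, sphereForm_fderiv_sphereChart hR₁ hu.1,
      sphereForm_fderiv_sphereChart hR₂ hu.2]
    simp only [northCoordinates_apply, southCoordinates_apply, standardForm]
    ring

end GaudinChart

/-! ### The Taylor expansion of the Gaudin Hamiltonian -/

/-- The haversine `(1 - z₁) / 2` of the polar angle on the first sphere, in canonical
coordinates. -/
noncomputable def northHaversine (R₁ : ℝ) : CanonicalSpace → ℝ :=
  (4 * R₁)⁻¹ • (hilbertM + hilbertN - hilbertS)

/-- The haversine `(1 + z₂) / 2` of the polar angle from the south pole on the second sphere, in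
canonical coordinates. -/
noncomputable def southHaversine (R₂ : ℝ) : CanonicalSpace → ℝ :=
  (4 * R₂)⁻¹ • (hilbertM + hilbertN + hilbertS)

theorem northHaversine_mem (R₁ : ℝ) : northHaversine R₁ ∈ invariantForms :=
  Submodule.smul_mem _ _ (sub_mem (add_mem hilbertM_mem hilbertN_mem) hilbertS_mem)

theorem southHaversine_mem (R₂ : ℝ) : southHaversine R₂ ∈ invariantForms :=
  Submodule.smul_mem _ _ (add_mem (add_mem hilbertM_mem hilbertN_mem) hilbertS_mem)

theorem haversine_northCoordinates (R₁ : ℝ) (u : CanonicalSpace) :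
    haversine R₁ (northCoordinates u) = northHaversine R₁ u := by
  simp only [haversine, northCoordinates_apply, northHaversine, Pi.smul_apply, Pi.add_apply,
    Pi.sub_apply, smul_eq_mul, hilbertM, hilbertN, hilbertS]
  ring

theorem haversine_southCoordinates (R₂ : ℝ) (u : CanonicalSpace) :
    haversine R₂ (southCoordinates u) = southHaversine R₂ u := by
  simp only [haversine, southCoordinates_apply, southHaversine, Pi.smul_apply, Pi.add_apply,
    smul_eq_mul, hilbertM, hilbertN, hilbertS]
  ring

/-- The product `cos (θ₁ / 2) cos (θ₂ / 2)`, where `θ₁` is the polar angle on the first sphere and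
`θ₂` is the polar angle from the south pole on the second. -/
noncomputable def halfAngleProduct (R₁ R₂ : ℝ) (u : CanonicalSpace) : ℝ :=
  √(1 - northHaversine R₁ u) * √(1 - southHaversine R₂ u)

/-- The coefficient of `N - M` in the second order part of the Hamiltonian. -/
noncomputable def gaudinBeta (R₁ R₂ t₃ : ℝ) : ℝ := t₃ / √(R₁ * R₂)

/-- The coefficient of `M + N` in the second order part of the Hamiltonian. -/
noncomputable def gaudinAlpha (R₁ R₂ t₁ t₂ t : ℝ) : ℝ :=
  (t - t₁) / (2 * R₁) + (t + t₂) / (2 * R₂)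

/-- The coefficient of `S` in the second order part of the Hamiltonian. -/
noncomputable def gaudinRho (R₁ R₂ t₁ t₂ t : ℝ) : ℝ :=
  (t + t₂) / (2 * R₂) - (t - t₁) / (2 * R₁)

section Expansion

variable {R₁ R₂ : ℝ}

theorem localExpression_gaudinJ (hR₁ : 0 < R₁) (hR₂ : 0 < R₂) :
    localExpression (gaudinJ R₁ R₂) gaudinM0 (gaudinChart R₁ R₂) = hilbertS := by
  funext u
  simp only [localExpression, gaudinJ, gaudinChart, gaudinM0, sphereChart, halfTurn_apply,
    haversine_northCoordinates, haversine_southCoordinates, northHaversine, southHaversine,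
    Matrix.cons_val, Pi.smul_apply, Pi.add_apply, Pi.sub_apply, smul_eq_mul]
  field_simp
  ring

theorem horizontal_product_gaudinChart (hR₁ : 0 < R₁) (hR₂ : 0 < R₂) (u : CanonicalSpace) :
    (gaudinChart R₁ R₂ u).1 0 * (gaudinChart R₁ R₂ u).2 0
      + (gaudinChart R₁ R₂ u).1 1 * (gaudinChart R₁ R₂ u).2 1
      = (hilbertN u - hilbertM u) * halfAngleProduct R₁ R₂ u / √(R₁ * R₂) := by
  have factor_product : √(2 * R₁) * √(2 * R₂) = 2 * √(R₁ * R₂) := by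
    rw [← Real.sqrt_mul (by positivity), show 2 * R₁ * (2 * R₂) = 2 ^ 2 * (R₁ * R₂) by ring,
      Real.sqrt_mul (by positivity), Real.sqrt_sq zero_le_two]
  have factors : sphereFactor R₁ (northCoordinates u) * sphereFactor R₂ (southCoordinates u)
      = halfAngleProduct R₁ R₂ u / (2 * √(R₁ * R₂)) := by
    rw [sphereFactor, sphereFactor, Real.sqrt_div' _ (by positivity),
      Real.sqrt_div' _ (by positivity), div_mul_div_comm, factor_product,
      haversine_northCoordinates, haversine_southCoordinates, halfAngleProduct]
  simp only [gaudinChart, sphereChart, halfTurn_apply, Matrix.cons_val, northCoordinates_apply,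
    southCoordinates_apply, hilbertN, hilbertM] at factors ⊢
  linear_combination (-(u 0 - u 3) * (u 0 + u 3) - (u 1 + u 2) * (u 1 - u 2)) * factors

theorem localExpression_rationalGaudinH (hR₁ : 0 < R₁) (hR₂ : 0 < R₂) (t₁ t₂ t₃ t : ℝ) :
    localExpression (rationalGaudinH t₁ t₂ t₃ t) gaudinM0 (gaudinChart R₁ R₂) =
      gaudinRho R₁ R₂ t₁ t₂ t • hilbertS + gaudinAlpha R₁ R₂ t₁ t₂ t • (hilbertM + hilbertN)
        - (4 * t) • (northHaversine R₁ * southHaversine R₂)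
        + gaudinBeta R₁ R₂ t₃ • ((hilbertN - hilbertM) * halfAngleProduct R₁ R₂) := by
  funext u
  have horizontal := horizontal_product_gaudinChart hR₁ hR₂ u
  have north_height : (gaudinChart R₁ R₂ u).1 2 = 1 - 2 * northHaversine R₁ u := by
    rw [← haversine_northCoordinates]
    rfl
  have south_height : (gaudinChart R₁ R₂ u).2 2 = -(1 - 2 * southHaversine R₂ u) := by
    rw [← haversine_southCoordinates]
    rfl
  have linear_part : 2 * (t - t₁) * northHaversine R₁ u + 2 * (t + t₂) * southHaversine R₂ u
      = gaudinRho R₁ R₂ t₁ t₂ t * hilbertS u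
        + gaudinAlpha R₁ R₂ t₁ t₂ t * (hilbertM u + hilbertN u) := by
    simp only [northHaversine, southHaversine, gaudinRho, gaudinAlpha, Pi.smul_apply,
      Pi.add_apply, Pi.sub_apply, smul_eq_mul]
    ring
  simp only [localExpression, rationalGaudinH, gaudinH, gaudinM0, gaudinBeta, north_height,
    south_height, Matrix.cons_val, Pi.smul_apply, Pi.add_apply, Pi.sub_apply, Pi.mul_apply,
    smul_eq_mul]
  linear_combination linear_part + t₃ * horizontal

theorem isBigO_sqrt_one_sub :
    (fun x : ℝ => √(1 - x) - (1 - x / 2 - x ^ 2 / 8)) =O[𝓝 0] fun x => x ^ 3 := by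
  have sum_pos : ∀ᶠ x : ℝ in 𝓝 0, 0 < √(1 - x) + (1 - x / 2 - x ^ 2 / 8) :=
    ContinuousAt.eventually_lt (by fun_prop) (by fun_prop) (by norm_num)
  have quotient_continuous : ContinuousAt
      (fun x : ℝ => -(8 + x) / 64 / (√(1 - x) + (1 - x / 2 - x ^ 2 / 8))) 0 :=
    ContinuousAt.div (by fun_prop) (by fun_prop) sum_pos.self_of_nhds.ne'
  refine ((isBigO_refl (fun x : ℝ => x ^ 3) (𝓝 0)).mul
    (quotient_continuous.tendsto.isBigO_one ℝ)).congr' ?_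
    (.of_forall fun x => mul_one _)
  filter_upwards [sum_pos, Iio_mem_nhds one_pos] with x hx hx_one
  have conjugate : √(1 - x) ^ 2 = 1 - x := Real.sq_sqrt (sub_nonneg.2 hx_one.le)
  rw [← mul_div_assoc, div_eq_iff hx.ne']
  linear_combination -conjugate

theorem tendsto_zero_of_mem_vanishing {F : CanonicalSpace → ℝ} {k : ℕ} (hk : k ≠ 0)
    (hF : F ∈ vanishing k) : Filter.Tendsto F (𝓝 0) (𝓝 0) := by
  refine IsBigO.trans_tendsto hF ?_
  have norm_pow_continuous : Continuous fun u : CanonicalSpace => ‖u‖ ^ k := by fun_prop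
  simpa [hk] using norm_pow_continuous.tendsto 0

theorem sqrt_mul_sqrt_sub_mem {X Y : CanonicalSpace → ℝ} (hX : X ∈ vanishing 2)
    (hY : Y ∈ vanishing 2) :
    (fun u => √(1 - X u) * √(1 - Y u)) - (1 - (2 : ℝ)⁻¹ • (X + Y) - (8 : ℝ)⁻¹ • (X - Y) ^ 2)
      ∈ vanishing 6 := by
  have hXY : X * Y ∈ vanishing 4 := mul_mem_vanishing hX hY
  have hW : X + Y - X * Y ∈ vanishing 2 :=
    sub_mem (add_mem hX hY) (vanishing_antitone (by norm_num) hXY)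
  have sqrt_expansion : (fun u => √(1 - (X + Y - X * Y) u) - (1 - (X + Y - X * Y) u / 2
      - (X + Y - X * Y) u ^ 2 / 8)) ∈ vanishing 6 := by
    have power : (X + Y - X * Y) ^ 3 ∈ vanishing 6 := by
      have h := mul_mem_vanishing (mul_mem_vanishing hW hW) hW
      convert h using 1
      ring
    exact (isBigO_sqrt_one_sub.comp_tendsto (tendsto_zero_of_mem_vanishing two_ne_zero hW)).trans
      power
  have remainder : (4 : ℝ)⁻¹ • ((X + Y) * (X * Y)) - (8 : ℝ)⁻¹ • (X * Y * (X * Y))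
      ∈ vanishing 6 :=
    sub_mem (Submodule.smul_mem _ _ (mul_mem_vanishing (add_mem hX hY) hXY))
      (Submodule.smul_mem _ _ (vanishing_antitone (by norm_num) (mul_mem_vanishing hXY hXY)))
  refine IsBigO.congr' (add_mem sqrt_expansion remainder) ?_ .rfl
  filter_upwards [(tendsto_zero_of_mem_vanishing two_ne_zero hX).eventually_lt_const one_pos]
    with u hu
  have product : √(1 - (X + Y - X * Y) u) = √(1 - X u) * √(1 - Y u) := by
    rw [← Real.sqrt_mul (sub_nonneg.2 hu.le)]
    congr 1
    simp only [Pi.sub_apply, Pi.add_apply, Pi.mul_apply]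
    ring
  simp only [Pi.add_apply, Pi.sub_apply, Pi.mul_apply, Pi.smul_apply, Pi.pow_apply, Pi.one_apply,
    smul_eq_mul] at product ⊢
  linear_combination product

theorem halfAngleProduct_sub_mem :
    halfAngleProduct R₁ R₂ - (1 - (2 : ℝ)⁻¹ • (northHaversine R₁ + southHaversine R₂)
      - (8 : ℝ)⁻¹ • (northHaversine R₁ - southHaversine R₂) ^ 2) ∈ vanishing 6 :=
  sqrt_mul_sqrt_sub_mem (invariantForms_le_vanishing (northHaversine_mem R₁))
    (invariantForms_le_vanishing (southHaversine_mem R₂))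

/-- The fourth order part of the Hamiltonian at `t = τ`. -/
noncomputable def gaudinQuartic (R₁ R₂ β τ : ℝ) : CanonicalSpace → ℝ :=
  -(4 * τ) • (northHaversine R₁ * southHaversine R₂)
    - (β / 2) • ((hilbertN - hilbertM) * (northHaversine R₁ + southHaversine R₂))

/-- The sixth order part of the Hamiltonian. -/
noncomputable def gaudinSextic (R₁ R₂ β : ℝ) : CanonicalSpace → ℝ :=
  -(β / 8) • ((hilbertN - hilbertM) * (northHaversine R₁ - southHaversine R₂) ^ 2)

theorem gaudinQuartic_mem (β τ : ℝ) : gaudinQuartic R₁ R₂ β τ ∈ invariantForms ^ 2 := by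
  have hX := northHaversine_mem R₁
  have hY := southHaversine_mem R₂
  rw [pow_two]
  exact sub_mem (Submodule.smul_mem _ _ (Submodule.mul_mem_mul hX hY)) (Submodule.smul_mem _ _
    (Submodule.mul_mem_mul (sub_mem hilbertN_mem hilbertM_mem) (add_mem hX hY)))

theorem gaudinSextic_mem (β : ℝ) : gaudinSextic R₁ R₂ β ∈ invariantForms ^ 3 := by
  rw [gaudinSextic, pow_succ']
  exact Submodule.smul_mem _ _ (Submodule.mul_mem_mul (sub_mem hilbertN_mem hilbertM_mem)
    (Submodule.pow_mem_pow _ (sub_mem (northHaversine_mem R₁) (southHaversine_mem R₂)) 2))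

theorem gaudinQuartic_axis (hR₁ : R₁ ≠ 0) (hR₂ : R₂ ≠ 0) {β τ : ℝ}
    (hτ : τ = β * (R₁ + R₂) / 2) : gaudinQuartic R₁ R₂ β τ ![1, 0, 0, 0] = 0 := by
  simp only [gaudinQuartic, northHaversine, southHaversine, hilbertM, hilbertN, hilbertS,
    Pi.sub_apply, Pi.smul_apply, Pi.mul_apply, Pi.add_apply, smul_eq_mul, Matrix.cons_val, hτ]
  field_simp
  ring

theorem rationalGaudinH_sixth_order (hR₁ : 0 < R₁) (hR₂ : 0 < R₂) (t₁ t₂ t₃ t : ℝ) :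
    localExpression (rationalGaudinH t₁ t₂ t₃ t) gaudinM0 (gaudinChart R₁ R₂)
      - (gaudinRho R₁ R₂ t₁ t₂ t • hilbertS
        + (gaudinAlpha R₁ R₂ t₁ t₂ t + gaudinBeta R₁ R₂ t₃) • hilbertN
        + (gaudinAlpha R₁ R₂ t₁ t₂ t - gaudinBeta R₁ R₂ t₃) • hilbertM
        + gaudinQuartic R₁ R₂ (gaudinBeta R₁ R₂ t₃) t
        + gaudinSextic R₁ R₂ (gaudinBeta R₁ R₂ t₃)) ∈ vanishing 8 := by
  have remainder := Submodule.smul_mem _ (gaudinBeta R₁ R₂ t₃) (mul_mem_vanishing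
    (invariantForms_le_vanishing (sub_mem hilbertN_mem hilbertM_mem))
    (halfAngleProduct_sub_mem (R₁ := R₁) (R₂ := R₂)))
  rw [localExpression_rationalGaudinH hR₁ hR₂]
  convert remainder using 1
  funext u
  simp only [gaudinQuartic, gaudinSextic, Pi.add_apply, Pi.sub_apply, Pi.mul_apply, Pi.smul_apply,
    Pi.pow_apply, Pi.one_apply, smul_eq_mul]
  ring

theorem rationalGaudinH_second_order (hR₁ : 0 < R₁) (hR₂ : 0 < R₂) (t₁ t₂ t₃ t : ℝ) :
    localExpression (rationalGaudinH t₁ t₂ t₃ t) gaudinM0 (gaudinChart R₁ R₂)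
      - (gaudinRho R₁ R₂ t₁ t₂ t • hilbertS
        + (gaudinAlpha R₁ R₂ t₁ t₂ t + gaudinBeta R₁ R₂ t₃) • hilbertN
        + (gaudinAlpha R₁ R₂ t₁ t₂ t - gaudinBeta R₁ R₂ t₃) • hilbertM) ∈ vanishing 4 := by
  have quartic : gaudinQuartic R₁ R₂ (gaudinBeta R₁ R₂ t₃) t ∈ vanishing 4 :=
    pow_le_vanishing 2 (gaudinQuartic_mem _ _)
  have sextic : gaudinSextic R₁ R₂ (gaudinBeta R₁ R₂ t₃) ∈ vanishing 4 :=
    vanishing_antitone (by norm_num) (pow_le_vanishing 3 (gaudinSextic_mem _))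
  have remainder := vanishing_antitone (show 4 ≤ 8 by norm_num)
    (rationalGaudinH_sixth_order hR₁ hR₂ t₁ t₂ t₃ t)
  convert add_mem (add_mem remainder quartic) sextic using 1
  abel

end Expansion

theorem sq_sub_le_four_mul_sq_sqrt_sub_sqrt {a b : ℝ} (ha : a ∈ Icc 0 1) (hb : b ∈ Icc 0 1) :
    (a - b) ^ 2 ≤ 4 * (√a - √b) ^ 2 := by
  have factorization : a - b = (√a - √b) * (√a + √b) := by
    linear_combination -Real.sq_sqrt ha.1 + Real.sq_sqrt hb.1
  have sum_le_two : √a + √b ≤ 2 := by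
    linarith [Real.sqrt_le_one.2 ha.2, Real.sqrt_le_one.2 hb.2]
  calc (a - b) ^ 2 = (√a - √b) ^ 2 * (√a + √b) ^ 2 := by rw [factorization, mul_pow]
    _ ≤ (√a - √b) ^ 2 * 2 ^ 2 := by gcongr
    _ = 4 * (√a - √b) ^ 2 := by ring

section LowerBound

variable {R₁ R₂ t₁ t₂ t₃ τ : ℝ} {u : CanonicalSpace}

theorem localExpression_rationalGaudinH_of_hilbertS_eq_zero (hR₁ : 0 < R₁) (hR₂ : 0 < R₂)
    (hα : gaudinAlpha R₁ R₂ t₁ t₂ τ = gaudinBeta R₁ R₂ t₃)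
    (hτ : τ = gaudinBeta R₁ R₂ t₃ * (R₁ + R₂) / 2) (hS : hilbertS u = 0)
    (hX : northHaversine R₁ u ≤ 1) (hY : southHaversine R₂ u ≤ 1) :
    localExpression (rationalGaudinH t₁ t₂ t₃ τ) gaudinM0 (gaudinChart R₁ R₂) u =
      gaudinBeta R₁ R₂ t₃ * ((hilbertM u + hilbertN u) / 2
        * (√(1 - northHaversine R₁ u) - √(1 - southHaversine R₂ u)) ^ 2
        + 2 * hilbertN u * halfAngleProduct R₁ R₂ u) := by
  have north_sq := Real.sq_sqrt (sub_nonneg.2 hX)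
  have south_sq := Real.sq_sqrt (sub_nonneg.2 hY)
  have quartic : 4 * τ * (northHaversine R₁ u * southHaversine R₂ u) = gaudinBeta R₁ R₂ t₃
      * ((hilbertM u + hilbertN u) / 2) * (northHaversine R₁ u + southHaversine R₂ u) := by
    simp only [northHaversine, southHaversine, Pi.smul_apply, Pi.add_apply, Pi.sub_apply,
      smul_eq_mul, hS, hτ]
    field_simp
    ring
  rw [localExpression_rationalGaudinH hR₁ hR₂]
  simp only [halfAngleProduct, Pi.smul_apply, Pi.add_apply, Pi.sub_apply, Pi.mul_apply,
    smul_eq_mul, hS, hα]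
  linear_combination -quartic
    - gaudinBeta R₁ R₂ t₃ * ((hilbertM u + hilbertN u) / 2) * (north_sq + south_sq)

theorem hilbertM_nonneg (u : CanonicalSpace) : 0 ≤ hilbertM u := by
  unfold hilbertM
  positivity

theorem hilbertN_nonneg (u : CanonicalSpace) : 0 ≤ hilbertN u := by
  unfold hilbertN
  positivity

theorem northHaversine_sub_southHaversine (hS : hilbertS u = 0) :
    northHaversine R₁ u - southHaversine R₂ u
      = (R₁⁻¹ - R₂⁻¹) / 4 * (hilbertM u + hilbertN u) := by
  simp only [northHaversine, southHaversine, Pi.smul_apply, Pi.add_apply, Pi.sub_apply,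
    smul_eq_mul, hS]
  ring

theorem northHaversine_nonneg (hR₁ : 0 < R₁) : 0 ≤ northHaversine R₁ u := by
  rw [← haversine_northCoordinates, haversine]
  positivity

theorem southHaversine_nonneg (hR₂ : 0 < R₂) : 0 ≤ southHaversine R₂ u := by
  rw [← haversine_southCoordinates, haversine]
  positivity

theorem mul_hilbertM_cube_le (hR₁ : 0 < R₁) (hR₂ : 0 < R₂)
    (hα : gaudinAlpha R₁ R₂ t₁ t₂ τ = gaudinBeta R₁ R₂ t₃)
    (hτ : τ = gaudinBeta R₁ R₂ t₃ * (R₁ + R₂) / 2) (hS : hilbertS u = 0)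
    (hX : northHaversine R₁ u ≤ 1) (hY : southHaversine R₂ u ≤ 1) :
    |gaudinBeta R₁ R₂ t₃| * ((R₁⁻¹ - R₂⁻¹) ^ 2 / 128) * hilbertM u ^ 3 ≤
      |localExpression (rationalGaudinH t₁ t₂ t₃ τ) gaudinM0 (gaudinChart R₁ R₂) u| := by
  have hM := hilbertM_nonneg u
  have hN := hilbertN_nonneg u
  have hP : 0 ≤ halfAngleProduct R₁ R₂ u := by
    unfold halfAngleProduct
    positivity
  have sqrt_gap := sq_sub_le_four_mul_sq_sqrt_sub_sqrt
    (a := 1 - northHaversine R₁ u) (b := 1 - southHaversine R₂ u)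
    ⟨sub_nonneg.2 hX, sub_le_self _ (northHaversine_nonneg hR₁)⟩
    ⟨sub_nonneg.2 hY, sub_le_self _ (southHaversine_nonneg hR₂)⟩
  rw [sub_sub_sub_cancel_left, ← neg_sub, neg_sq, northHaversine_sub_southHaversine hS] at sqrt_gap
  rw [localExpression_rationalGaudinH_of_hilbertS_eq_zero hR₁ hR₂ hα hτ hS hX hY, abs_mul,
    abs_of_nonneg (a := _ + _) (by positivity), mul_assoc]
  refine mul_le_mul_of_nonneg_left ?_ (abs_nonneg _)
  calc (R₁⁻¹ - R₂⁻¹) ^ 2 / 128 * hilbertM u ^ 3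
      ≤ (R₁⁻¹ - R₂⁻¹) ^ 2 / 128 * (hilbertM u + hilbertN u) ^ 3 := by
        gcongr
        exact le_add_of_nonneg_right hN
    _ = (hilbertM u + hilbertN u) / 2
        * (((R₁⁻¹ - R₂⁻¹) / 4 * (hilbertM u + hilbertN u)) ^ 2 / 4) := by ring
    _ ≤ (hilbertM u + hilbertN u) / 2
        * (√(1 - northHaversine R₁ u) - √(1 - southHaversine R₂ u)) ^ 2 := by
        gcongr
        linarith
    _ ≤ _ := le_add_of_nonneg_right (by positivity)

theorem hilbertM_cube_isBigO_localExpression (hR₁ : 0 < R₁) (hR₂ : 0 < R₂) (hR : R₁ ≠ R₂)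
    (hβ : gaudinBeta R₁ R₂ t₃ ≠ 0) (hα : gaudinAlpha R₁ R₂ t₁ t₂ τ = gaudinBeta R₁ R₂ t₃)
    (hτ : τ = gaudinBeta R₁ R₂ t₃ * (R₁ + R₂) / 2) :
    (hilbertM ^ 3) =O[𝓝[{u | hilbertS u = 0}] 0]
      localExpression (rationalGaudinH t₁ t₂ t₃ τ) gaudinM0 (gaudinChart R₁ R₂) := by
  have gap_pos : 0 < |gaudinBeta R₁ R₂ t₃| * ((R₁⁻¹ - R₂⁻¹) ^ 2 / 128) := by
    have : R₁⁻¹ - R₂⁻¹ ≠ 0 := sub_ne_zero.2 (inv_injective.ne hR)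
    positivity
  have north_small := (tendsto_zero_of_mem_vanishing two_ne_zero
    (invariantForms_le_vanishing (northHaversine_mem R₁))).eventually_le_const one_pos
  have south_small := (tendsto_zero_of_mem_vanishing two_ne_zero
    (invariantForms_le_vanishing (southHaversine_mem R₂))).eventually_le_const one_pos
  refine IsBigO.of_bound (|gaudinBeta R₁ R₂ t₃| * ((R₁⁻¹ - R₂⁻¹) ^ 2 / 128))⁻¹ ?_
  filter_upwards [self_mem_nhdsWithin, nhdsWithin_le_nhds north_small,
    nhdsWithin_le_nhds south_small] with u hS hX hY
  rw [Pi.pow_apply, Real.norm_of_nonneg (pow_nonneg (hilbertM_nonneg u) 3), Real.norm_eq_abs,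
    inv_mul_eq_div, le_div_iff₀' gap_pos]
  exact mul_hilbertM_cube_le hR₁ hR₂ hα hτ hS hX hY

end LowerBound

/-! ### The resonance parameters -/

section Parameters

variable {R₁ R₂ t₁ t₂ t₃ : ℝ}

theorem contDiff_gaudinAlpha : ContDiff ℝ ∞ (gaudinAlpha R₁ R₂ t₁ t₂) := by
  unfold gaudinAlpha
  fun_prop

theorem contDiff_gaudinRho : ContDiff ℝ ∞ (gaudinRho R₁ R₂ t₁ t₂) := by
  unfold gaudinRho
  fun_prop

theorem hasDerivAt_gaudinAlpha (t : ℝ) :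
    HasDerivAt (gaudinAlpha R₁ R₂ t₁ t₂) (1 / (2 * R₁) + 1 / (2 * R₂)) t :=
  (((hasDerivAt_id t).sub_const t₁).div_const _).add (((hasDerivAt_id t).add_const t₂).div_const _)

theorem gaudinBeta_mul_sq (hR₁ : 0 < R₁) (hR₂ : 0 < R₂) (hR : R₁ ≠ R₂)
    (ht₃ : t₃ = 2 * √(R₁ * R₂) * (R₂ * t₁ - R₁ * t₂) / (R₁ - R₂) ^ 2) :
    gaudinBeta R₁ R₂ t₃ * (R₁ - R₂) ^ 2 = 2 * (R₂ * t₁ - R₁ * t₂) := by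
  have hR' := sub_ne_zero.2 hR
  rw [gaudinBeta, ht₃]
  field_simp

theorem gaudinBeta_ne_zero (hR₁ : 0 < R₁) (hR₂ : 0 < R₂) (hR : R₁ ≠ R₂)
    (ht₃ : t₃ = 2 * √(R₁ * R₂) * (R₂ * t₁ - R₁ * t₂) / (R₁ - R₂) ^ 2)
    (h₁ : R₁ * t₂ ≠ R₂ * t₁) : gaudinBeta R₁ R₂ t₃ ≠ 0 :=
  left_ne_zero_of_mul <| (gaudinBeta_mul_sq hR₁ hR₂ hR ht₃).trans_ne
    (mul_ne_zero two_ne_zero (sub_ne_zero.2 h₁.symm))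

theorem t4m0Plus_eq (hR₁ : 0 < R₁) (hR₂ : 0 < R₂) (hR : R₁ ≠ R₂)
    (ht₃ : t₃ = 2 * √(R₁ * R₂) * (R₂ * t₁ - R₁ * t₂) / (R₁ - R₂) ^ 2) :
    t4m0Plus R₁ R₂ 1 t₁ t₂ t₃ = gaudinBeta R₁ R₂ t₃ * (R₁ + R₂) / 2 := by
  have resonance := gaudinBeta_mul_sq hR₁ hR₂ hR ht₃
  have ht₃_eq : t₃ = gaudinBeta R₁ R₂ t₃ * √(R₁ * R₂) := by
    rw [gaudinBeta]
    field_simp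
  have sqrt_sq : √(R₁ * R₂) ^ 2 = R₁ * R₂ := Real.sq_sqrt (by positivity)
  rw [t4m0Plus, div_eq_iff (by positivity)]
  linear_combination (-1 / 2) * resonance + 2 * gaudinBeta R₁ R₂ t₃ * sqrt_sq
    + 2 * √(R₁ * R₂) * ht₃_eq

theorem gaudinAlpha_t4m0Plus (hR₁ : 0 < R₁) (hR₂ : 0 < R₂) (hR : R₁ ≠ R₂)
    (ht₃ : t₃ = 2 * √(R₁ * R₂) * (R₂ * t₁ - R₁ * t₂) / (R₁ - R₂) ^ 2) :
    gaudinAlpha R₁ R₂ t₁ t₂ (t4m0Plus R₁ R₂ 1 t₁ t₂ t₃) = gaudinBeta R₁ R₂ t₃ := by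
  rw [gaudinAlpha, t4m0Plus_eq hR₁ hR₂ hR ht₃]
  field_simp
  linear_combination gaudinBeta_mul_sq hR₁ hR₂ hR ht₃

theorem gaudinRho_t4m0Plus_ne_zero (hR₁ : 0 < R₁) (hR₂ : 0 < R₂) (hR : R₁ ≠ R₂)
    (ht₃ : t₃ = 2 * √(R₁ * R₂) * (R₂ * t₁ - R₁ * t₂) / (R₁ - R₂) ^ 2) (h₃ : t₁ ≠ t₂) :
    gaudinRho R₁ R₂ t₁ t₂ (t4m0Plus R₁ R₂ 1 t₁ t₂ t₃) ≠ 0 := by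
  have resonance : gaudinRho R₁ R₂ t₁ t₂ (t4m0Plus R₁ R₂ 1 t₁ t₂ t₃) * (R₁ - R₂) = t₁ - t₂ := by
    rw [gaudinRho, t4m0Plus_eq hR₁ hR₂ hR ht₃]
    field_simp
    linear_combination (R₁ + R₂) * gaudinBeta_mul_sq hR₁ hR₂ hR ht₃
  exact left_ne_zero_of_mul (resonance.trans_ne (sub_ne_zero.2 h₃))

end Parameters

theorem corollary5p3_general (R₁ R₂ t₁ t₂ t₃ : ℝ) (hR₁ : 0 < R₁) (hR₂ : 0 < R₂)
    (hR : R₁ ≠ R₂)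
    (ht₃ : t₃ = 2 * √(R₁ * R₂) * (R₂ * t₁ - R₁ * t₂) / (R₁ - R₂) ^ 2)
    (h₁ : R₁ * t₂ ≠ R₂ * t₁)
    (h₃ : t₁ ≠ t₂) :
    DegenerateHamiltonianHopf R₁ R₂ (gaudinJ R₁ R₂)
      (fun t₄ => rationalGaudinH t₁ t₂ t₃ t₄) gaudinM0 (t4m0Plus R₁ R₂ 1 t₁ t₂ t₃) := by
  have hα := gaudinAlpha_t4m0Plus hR₁ hR₂ hR ht₃
  have hτ := t4m0Plus_eq hR₁ hR₂ hR ht₃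
  have hβ := gaudinBeta_ne_zero hR₁ hR₂ hR ht₃ h₁
  have hJ : localExpression (gaudinJ R₁ R₂) gaudinM0 (gaudinChart R₁ R₂) ∈ vanishing 2 :=
    (localExpression_gaudinJ hR₁ hR₂).symm ▸ invariantForms_le_vanishing hilbertS_mem
  have alpha_deriv_ne : 1 / (2 * R₁) + 1 / (2 * R₂) ≠ 0 := by positivity
  have sixth_order := rationalGaudinH_sixth_order hR₁ hR₂ t₁ t₂ t₃ (t4m0Plus R₁ R₂ 1 t₁ t₂ t₃)
  rw [sub_eq_zero.2 hα, zero_smul, add_zero] at sixth_order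
  exact degenerateHamiltonianHopf_of_expansion (isCanonicalCoordinates_gaudinChart hR₁ hR₂) hJ
    (rationalGaudinH_second_order hR₁ hR₂ t₁ t₂ t₃) contDiff_gaudinRho
    (contDiff_gaudinAlpha.add contDiff_const) (contDiff_gaudinAlpha.sub contDiff_const)
    (gaudinRho_t4m0Plus_ne_zero hR₁ hR₂ hR ht₃ h₃) (by simpa [hα] using hβ) (sub_eq_zero.2 hα)
    (((hasDerivAt_gaudinAlpha _).sub_const _).deriv.trans_ne alpha_deriv_ne)
    (gaudinQuartic_mem _ _) (gaudinQuartic_axis hR₁.ne' hR₂.ne' hτ)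
    (pow_le_invariantsFrom le_rfl (gaudinSextic_mem _))
    (vanishing_antitone (by norm_num) sixth_order)
    (hilbertM_cube_isBigO_localExpression hR₁ hR₂ hR hβ hα hτ)

theorem corollary5p3 (R₁ R₂ t₁ t₂ t₃ : ℝ) (hR₁ : 0 < R₁) (hR₂ : 0 < R₂)
    (hR : R₁ ≠ R₂)
    (ht₃ : t₃ = 2 * √(R₁ * R₂) * (R₂ * t₁ - R₁ * t₂) / (R₁ - R₂) ^ 2)
    (h₁ : R₁ * t₂ ≠ R₂ * t₁)
    (h₂ : R₁ * (t₁ + 2 * t₂) ≠ R₂ * (2 * t₁ + t₂))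
    (h₃ : t₁ ≠ t₂) :
    DegenerateHamiltonianHopf R₁ R₂ (gaudinJ R₁ R₂)
      (fun t₄ => rationalGaudinH t₁ t₂ t₃ t₄) gaudinM0 (t4m0Plus R₁ R₂ 1 t₁ t₂ t₃) :=
  corollary5p3_general R₁ R₂ t₁ t₂ t₃ hR₁ hR₂ hR ht₃ h₁ h₃
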